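/- Let $X$ be a normal proper variety over $\mathbb{C}$ (an integral normal scheme, proper over $\mathbb{C}$) and let $i\colon\Delta\hookrightarrow X$ be a reduced Weil divisor (possibly $0$), regarded as a reduced closed subscheme with ideal sheaf $\mathcal I$. Let $U\subset X$ be the open subset where $(X,\Delta)$ is log smooth ($X$ regular and $\Delta$ with simple normal crossings), with inclusion $j$; its complement has codimension at least $2$. Put $$\Omega^{[1]}_X(\log\Delta)=j_*\Omega^1_U(\log\Delta|_U),\qquad T_X(-\log\Delta)=\mathcal Hom(\Omega^{[1]}_X(\log\Delta),\mathcal O_X),$$ and let $H^0(X,T_X)$ be the space of $\mathbb{C}$-derivations of the sheaf $\mathcal O_X$ to itself. For a $\mathbb{C}$-scheme $S$ let $A_X(S)=\mathrm{Aut}_S(X_S)$, and let $A_{X,\Delta}(S)\subset A_X(S)$ be the set of those $\sigma$ for which $\sigma\circ i_S\colon\Delta_S\to X_S$ factors through $i_S\colon\Delta_S\to X_S$. Let $\mathrm{Aut}(X,\Delta)$ denote the scheme representing the functor $A_{X,\Delta}$, and let $$\mathrm{Lie}(A_{X,\Delta})=\{\sigma\in A_{X,\Delta}(\operatorname{Spec}\mathbb{C}[\varepsilon])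 : \sigma\equiv \mathrm{id} \bmod \varepsilon\},\qquad \varepsilon^2=0,$$ with addition given by composition and multiplication by $c\in\mathbb{C}$ given by base change along $\varepsilon\mapsto c\varepsilon$. Then: 1. The map $H^0(X,T_X(-\log\Delta))\to H^0(X,T_X)$, $\varphi\mapsto(a\mapsto\varphi(da))$, is injective. 2. There is a $\mathbb{C}$-linear isomorphism $e\colon\mathrm{Lie}(A_{X,\Delta})\to H^0(X,T_X(-\log\Delta))$ such that, for every $\sigma\in \mathrm{Lie}(A_{X,\Delta})$, the automorphism $\sigma$ is the identity on the underlying space of $X\times\operatorname{Spec}\mathbb{C}[\varepsilon]$ and acts on local functions $a$ of $X$ by $\sigma^\#(a)=a+\varepsilon\,\partial a$, where $\partial$ is the derivation that corresponds to $e(\sigma)$ by part 1. 3. For every scheme $G=\mathrm{Aut}(X,\Delta)$ representing $A_{X,\Delta}$, with identity point $1\in G(\mathbb{C})$, there is a $\mathbb{C}$-linear isomorphism $$T_1G=(\mathfrak m_1/\mathfrak m_1^2)^\vee\;\cong\; H^0(X,T_X(-\log\Delta))$$ that sends a tangent vector $v$ to $e(\sigma_v)$, where $\sigma_v\in\mathrm{Lie}(A_{X,\Delta})$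 corresponds to the morphism $\operatorname{Spec}\mathbb{C}[\varepsilon]\to G$ defined by $v$. -/

import Mathlib

open CategoryTheory MonoidalCategory CartesianMonoidalCategory AlgebraicGeometry Opposite
open scoped KaehlerDifferential

noncomputable section

namespace LogAut

/-! ### Schemes over the complex numbers -/

/-- The category of schemes over `ℂ`; the product `X ⊗ S` is the fibre product over `ℂ`. -/
abbrev CSch : Type 1 := Over (Spec (CommRingCat.of ℂ))

/-- The point `Spec ℂ`. -/
abbrev pt : CSch := Over.mk (𝟙 (Spec (CommRingCat.of ℂ)))

theorem le_preimage_top {Y Z : Scheme} (f : Y ⟶ Z) (U : Y.Opens) : U ≤ f ⁻¹ᵁ ⊤ :=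
  fun _ _ => trivial

/-- The constants `ℂ → Γ(X, U)`. -/
def scalar (X : CSch) (U : X.left.Opens) : ℂ →+* Γ(X.left, U) :=
  ((Scheme.ΓSpecIso (CommRingCat.of ℂ)).inv ≫ X.hom.appLE ⊤ U (le_preimage_top X.hom U)).hom

instance algSections (X : CSch) (U : X.left.Opens) : Algebra ℂ Γ(X.left, U) :=
  (scalar X U).toAlgebra

instance algStalk (X : CSch) (x : X.left) : Algebra ℂ (X.left.presheaf.stalk x) :=
  ((X.left.presheaf.germ ⊤ x trivial).hom.comp (scalar X ⊤)).toAlgebra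

/-- Restriction of functions from `U` to `V`. -/
abbrev res (X : CSch) {U V : X.left.Opens} (h : V ≤ U) : Γ(X.left, U) →+* Γ(X.left, V) :=
  (X.left.presheaf.map (homOfLE h).op).hom

theorem res_scalar (X : CSch) {U V : X.left.Opens} (h : V ≤ U) (c : ℂ) :
    res X h (algebraMap ℂ Γ(X.left, U) c) = algebraMap ℂ Γ(X.left, V) c := by
  change (X.left.presheaf.map (homOfLE h).op).hom (scalar X U c) = scalar X V c
  have H : ((Scheme.ΓSpecIso (CommRingCat.of ℂ)).inv ≫ X.hom.appLE ⊤ U (le_preimage_top X.hom U)) ≫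
      X.left.presheaf.map (homOfLE h).op =
      (Scheme.ΓSpecIso (CommRingCat.of ℂ)).inv ≫ X.hom.appLE ⊤ V (le_preimage_top X.hom V) := by
    rw [Category.assoc, Scheme.Hom.appLE_map]
  exact ConcreteCategory.congr_hom H c

theorem germ_scalar (X : CSch) (U : X.left.Opens) (x : X.left) (hx : x ∈ U) (c : ℂ) :
    X.left.presheaf.germ U x hx (algebraMap ℂ Γ(X.left, U) c) =
      algebraMap ℂ (X.left.presheaf.stalk x) c := by
  rw [← res_scalar X (le_top : U ≤ ⊤) c]
  exact TopCat.Presheaf.germ_res_apply X.left.presheaf (homOfLE le_top) x hx _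

theorem res_smul (X : CSch) {U V : X.left.Opens} (h : V ≤ U) (c : ℂ) (a : Γ(X.left, U)) :
    res X h (c • a) = c • res X h a := by
  rw [Algebra.smul_def, Algebra.smul_def, map_mul, res_scalar]

/-! ### The automorphism functor and the subfunctor preserving a closed subscheme -/

/-- `Aut_S(X_S)`, where `X_S = X ⊗ S` is regarded as a scheme over `S`. -/
def autOver (X S : CSch) : Subgroup (Aut (X ⊗ S)) where
  carrier := {σ | σ.hom ≫ snd X S = snd X S}
  mul_mem' {σ τ} hσ hτ := by
    change (τ.hom ≫ σ.hom) ≫ snd X S = snd X S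
    rw [Category.assoc, hσ, hτ]
  one_mem' := by
    change 𝟙 _ ≫ snd X S = snd X S
    simp
  inv_mem' {σ} hσ := by
    exact (Iso.inv_comp_eq (show X ⊗ S ≅ X ⊗ S from σ)).2 hσ.symm

/-- The base change along `g : T ⟶ S` of an `S`-endomorphism of `X_S`. -/
def baseChange (X : CSch) {S T : CSch} (g : T ⟶ S) (u : X ⊗ S ⟶ X ⊗ S) : X ⊗ T ⟶ X ⊗ T :=
  lift (X ◁ g ≫ u ≫ fst X S) (snd X T)

theorem baseChange_comp_whisker (X : CSch) {S T : CSch} (g : T ⟶ S) (u : X ⊗ S ⟶ X ⊗ S)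
    (hu : u ≫ snd X S = snd X S) : baseChange X g u ≫ X ◁ g = X ◁ g ≫ u := by
  apply CartesianMonoidalCategory.hom_ext <;> simp [baseChange, hu]

theorem baseChange_comp (X : CSch) {S T : CSch} (g : T ⟶ S) (u v : X ⊗ S ⟶ X ⊗ S)
    (hu : u ≫ snd X S = snd X S) :
    baseChange X g (u ≫ v) = baseChange X g u ≫ baseChange X g v := by
  have h := baseChange_comp_whisker X g u hu
  apply CartesianMonoidalCategory.hom_ext
  · have : baseChange X g v ≫ fst X T = X ◁ g ≫ v ≫ fst X S := by simp [baseChange]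
    rw [Category.assoc, this, reassoc_of% h]
    simp [baseChange]
  · simp [baseChange]

theorem baseChange_id (X : CSch) {S T : CSch} (g : T ⟶ S) : baseChange X g (𝟙 _) = 𝟙 _ := by
  apply CartesianMonoidalCategory.hom_ext <;> simp [baseChange]

/-- Base change `Aut_S(X_S) → Aut_T(X_T)` along `g : T ⟶ S`. -/
def autBaseChange (X : CSch) {S T : CSch} (g : T ⟶ S) : autOver X S →* autOver X T where
  toFun σ := ⟨⟨baseChange X g σ.1.hom, baseChange X g σ.1.inv,
      (baseChange_comp X g _ _ σ.2).symm.trans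
        ((congrArg (baseChange X g) (Iso.hom_inv_id (show X ⊗ S ≅ X ⊗ S from σ.1))).trans
          (baseChange_id X g)),
      (baseChange_comp X g _ _ (inv_mem σ.2)).symm.trans
        ((congrArg (baseChange X g) (Iso.inv_hom_id (show X ⊗ S ≅ X ⊗ S from σ.1))).trans
          (baseChange_id X g))⟩,
    by change baseChange X g σ.1.hom ≫ snd X T = snd X T; simp [baseChange]⟩
  map_one' := Subtype.ext (Iso.ext (baseChange_id X g))
  map_mul' σ τ := Subtype.ext (Iso.ext (baseChange_comp X g τ.1.hom σ.1.hom τ.2))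

theorem autBaseChange_id (X S : CSch) (σ : autOver X S) : autBaseChange X (𝟙 S) σ = σ := by
  apply Subtype.ext
  apply Iso.ext
  change baseChange X (𝟙 _) σ.1.hom = σ.1.hom
  apply CartesianMonoidalCategory.hom_ext
  · simp [baseChange]
  · simpa [baseChange] using σ.2.symm

theorem autBaseChange_comp (X : CSch) {R S T : CSch} (h : R ⟶ T) (g : T ⟶ S) (σ : autOver X S) :
    autBaseChange X (h ≫ g) σ = autBaseChange X h (autBaseChange X g σ) := by
  apply Subtype.ext
  apply Iso.ext
  change baseChange X (h ≫ g) σ.1.hom = baseChange X h (baseChange X g σ.1.hom)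
  apply CartesianMonoidalCategory.hom_ext <;> simp [baseChange]

/-- The automorphism functor `A_X` with values in groups. -/
def autFunctor (X : CSch) : CSchᵒᵖ ⥤ GrpCat where
  obj S := GrpCat.of (autOver X S.unop)
  map g := GrpCat.ofHom (autBaseChange X g.unop)
  map_id S := ConcreteCategory.hom_ext _ _ fun σ => autBaseChange_id X S.unop σ
  map_comp g h := ConcreteCategory.hom_ext _ _ fun σ => autBaseChange_comp X h.unop g.unop σ

/-- The functor `A_{X,Δ}`: those `σ ∈ A_X(S)` for which `σ ∘ i_S : Δ_S → X_S` factors through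
`i_S : Δ_S → X_S`. -/
def autPairFunctor {X Δ : CSch} (i : Δ ⟶ X) : Subfunctor (autFunctor X ⋙ forget GrpCat) where
  obj S := {σ : autOver X S.unop |
    ∃ τ : Δ ⊗ S.unop ⟶ Δ ⊗ S.unop, (i ▷ S.unop) ≫ σ.1.hom = τ ≫ (i ▷ S.unop)}
  map {S T} g := by
    rintro (σ : autOver X S.unop) ⟨τ, hτ⟩
    refine ⟨lift (Δ ◁ g.unop ≫ τ ≫ fst Δ S.unop) (snd Δ T.unop), ?_⟩
    change (i ▷ T.unop) ≫ baseChange X g.unop σ.1.hom = _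
    have h1 : (i ▷ T.unop) ≫ X ◁ g.unop = Δ ◁ g.unop ≫ i ▷ S.unop := (whisker_exchange i g.unop).symm
    have h2 := congrArg (· ≫ fst X S.unop) hτ
    apply CartesianMonoidalCategory.hom_ext
    · simp only [Category.assoc, whiskerRight_fst] at h2
      simp [baseChange, reassoc_of% h1, h2]
    · simp [baseChange]

theorem mem_autPair {X Δ : CSch} (i : Δ ⟶ X) (S : CSch) (σ : autOver X S) :
    σ ∈ (autPairFunctor i).obj (op S) ↔
      ∃ τ : Δ ⊗ S ⟶ Δ ⊗ S, (i ▷ S) ≫ σ.1.hom = τ ≫ (i ▷ S) :=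
  Iff.rfl

theorem autPair_mul {X Δ : CSch} (i : Δ ⟶ X) (S : CSch) (σ τ : autOver X S)
    (hσ : σ ∈ (autPairFunctor i).obj (op S)) (hτ : τ ∈ (autPairFunctor i).obj (op S)) :
    (σ * τ : autOver X S) ∈ (autPairFunctor i).obj (op S) := by
  obtain ⟨f, hf⟩ := (mem_autPair i S σ).1 hσ
  obtain ⟨g, hg⟩ := (mem_autPair i S τ).1 hτ
  refine (mem_autPair i S _).2 ⟨g ≫ f, ?_⟩
  change (i ▷ S) ≫ τ.1.hom ≫ σ.1.hom = _
  rw [reassoc_of% hg, Category.assoc, hf]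

theorem autPair_baseChange {X Δ : CSch} (i : Δ ⟶ X) {S T : CSch} (g : T ⟶ S) (σ : autOver X S)
    (hσ : σ ∈ (autPairFunctor i).obj (op S)) :
    autBaseChange X g σ ∈ (autPairFunctor i).obj (op T) :=
  (autPairFunctor i).map g.op hσ

theorem autPair_one {X Δ : CSch} (i : Δ ⟶ X) (S : CSch) :
    (1 : autOver X S) ∈ (autPairFunctor i).obj (op S) :=
  (mem_autPair i S _).2 ⟨𝟙 _, (Category.comp_id _).trans (Category.id_comp _).symm⟩

/-! ### Dual numbers and the tangent space of `A_{X,Δ}` at the identity -/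

/-- `Spec ℂ[ε]`. -/
def dual : CSch :=
  Over.mk (Spec.map (CommRingCat.ofHom (algebraMap ℂ (DualNumber ℂ))))

/-- The function `ε` on `Spec ℂ[ε]`. -/
def epsilon : Γ(dual.left, ⊤) :=
  (Scheme.ΓSpecIso (CommRingCat.of (DualNumber ℂ))).inv (DualNumber.eps : DualNumber ℂ)

/-- The closed point `Spec ℂ ⟶ Spec ℂ[ε]`, given by `ε ↦ 0`. -/
def dualZero : pt ⟶ dual :=
  Over.homMk (Spec.map (CommRingCat.ofHom (TrivSqZeroExt.fstHom ℂ ℂ ℂ).toRingHom)) (by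
    change Spec.map _ ≫ Spec.map _ = 𝟙 _
    rw [← Spec.map_comp, ← Spec.map_id]
    rfl)

/-- The endomorphism `ε ↦ c ε` of `Spec ℂ[ε]`. -/
def dualScale (c : ℂ) : dual ⟶ dual :=
  Over.homMk (Spec.map (CommRingCat.ofHom
      (TrivSqZeroExt.map (c • (LinearMap.id : ℂ →ₗ[ℂ] ℂ))).toRingHom)) (by
    change Spec.map _ ≫ Spec.map _ = Spec.map _
    rw [← Spec.map_comp]
    congr 1
    refine ConcreteCategory.hom_ext _ _ fun x => ?_
    exact (TrivSqZeroExt.map (c • (LinearMap.id : ℂ →ₗ[ℂ] ℂ))).commutes x)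

theorem dualZero_scale (c : ℂ) : dualZero ≫ dualScale c = dualZero := by
  apply Over.OverMorphism.ext
  change Spec.map _ ≫ Spec.map _ = Spec.map _
  rw [← Spec.map_comp]
  congr 1
  refine ConcreteCategory.hom_ext _ _ fun x => ?_
  exact TrivSqZeroExt.fst_map _ x

/-- `Lie(A_{X,Δ})`: the elements of `A_{X,Δ}(ℂ[ε])` that reduce to the identity modulo `ε`, with
the composition of automorphisms. -/
def lie {X Δ : CSch} (i : Δ ⟶ X) : Submonoid (autOver X dual) where
  carrier := {σ | σ ∈ (autPairFunctor i).obj (op dual) ∧ autBaseChange X dualZero σ = 1}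
  mul_mem' hσ hτ := ⟨autPair_mul i _ _ _ hσ.1 hτ.1, by
    rw [map_mul, hσ.2, hτ.2, one_mul]⟩
  one_mem' := ⟨autPair_one i _, map_one _⟩

/-- Multiplication by scalars on `Lie(A_{X,Δ})`, induced by `ε ↦ c ε`. -/
def lieScale {X Δ : CSch} (i : Δ ⟶ X) (c : ℂ) (σ : lie i) : lie i :=
  ⟨autBaseChange X (dualScale c) σ.1,
    autPair_baseChange i _ σ.1 σ.2.1, by
      rw [← autBaseChange_comp, dualZero_scale]
      exact σ.2.2⟩

/-! ### Global vector fields -/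

/-- `H⁰(X, T_X)`: the `ℂ`-derivations of the sheaf `𝒪_X` to itself. -/
def VectorField (X : CSch) :
    Submodule ℂ (∀ U : X.left.Opens, Derivation ℂ Γ(X.left, U) Γ(X.left, U)) where
  carrier := {δ | ∀ (U V : X.left.Opens) (h : V ≤ U) (a : Γ(X.left, U)),
    δ V (res X h a) = res X h (δ U a)}
  zero_mem' U V h a := by simp
  add_mem' {δ δ'} hδ hδ' U V h a := by
    simp only [Pi.add_apply, Derivation.add_apply, map_add, hδ U V h a, hδ' U V h a]
  smul_mem' c δ hδ U V h a := by
    simp only [Pi.smul_apply, Derivation.smul_apply, hδ U V h a, res_smul]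

/-- The automorphism `σ` of `X ⊗ Spec ℂ[ε]` is `a ↦ a + ε ∂(a)`: it is the identity on the
underlying spaces, and it acts on functions `a` of `X` by this formula. -/
def IsOnePlusEps {X : CSch} (σ : autOver X dual) (δ : VectorField X) : Prop :=
  ∀ U : X.left.Opens, ∃ h : (σ.1.hom ≫ fst X dual).left ⁻¹ᵁ U = (fst X dual).left ⁻¹ᵁ U,
    ∀ a : Γ(X.left, U),
      (σ.1.hom ≫ fst X dual).left.appLE U ((fst X dual).left ⁻¹ᵁ U) h.ge a =
        (fst X dual).left.app U a +
          (snd X dual).left.appLE ⊤ ((fst X dual).left ⁻¹ᵁ U)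
              (le_preimage_top _ _) epsilon *
            (fst X dual).left.app U (δ.1 U a)

/-! ### Divisors, logarithmic forms and logarithmic vector fields -/

/-- `i` exhibits `Δ` as a reduced Weil divisor on `X` (possibly zero), endowed with its reduced
subscheme structure: a reduced closed subscheme all of whose irreducible components have
codimension one in `X`. -/
structure IsReducedDivisor {X Δ : CSch} (i : Δ ⟶ X) : Prop where
  isClosedImmersion : IsClosedImmersion i.left
  isReduced : IsReduced Δ.left
  codim_one : ∀ ξ ∈ genericPoints Δ.left, Order.coheight (i.left ξ) = 1

/-- The stalk at `x` of the ideal sheaf of `Δ`. -/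
def idealStalk {X Δ : CSch} (i : Δ ⟶ X) (x : X.left) : Ideal (X.left.presheaf.stalk x) :=
  ⨆ (U : X.left.Opens) (hx : x ∈ U),
    (RingHom.ker (i.left.app U).hom).map (X.left.presheaf.germ U x hx).hom

/-- `(X, Δ)` is log smooth at `x`: the local ring of `X` at `x` is regular, and the ideal of `Δ` is
generated there by a product of members of a regular system of parameters. -/
def IsLogSmoothAt {X Δ : CSch} (i : Δ ⟶ X) (x : X.left) : Prop :=
  IsRegularLocalRing (X.left.presheaf.stalk x) ∧
    ∃ (n : ℕ) (t : Fin n → X.left.presheaf.stalk x) (s : Finset (Fin n)),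
      ringKrullDim (X.left.presheaf.stalk x) = n ∧
      Ideal.span (Set.range t) = IsLocalRing.maximalIdeal (X.left.presheaf.stalk x) ∧
      idealStalk i x = Ideal.span {∏ j ∈ s, t j}

section Integral

variable {X Δ : CSch} [IsIntegral X.left]

instance smulCommStalk (x : X.left) :
    SMulCommClass ℂ (X.left.presheaf.stalk x) X.left.functionField :=
  ⟨fun a b c => by rw [Algebra.smul_def, Algebra.smul_def, Algebra.smul_def, Algebra.smul_def]; ring⟩

instance smulCommSections (U : X.left.Opens) [Nonempty U] :
    SMulCommClass ℂ Γ(X.left, U) X.left.functionField :=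
  ⟨fun a b c => by rw [Algebra.smul_def, Algebra.smul_def, Algebra.smul_def, Algebra.smul_def]; ring⟩

theorem germ_functionField (U : X.left.Opens) [Nonempty U] (x : X.left) (hx : x ∈ U)
    (a : Γ(X.left, U)) :
    algebraMap Γ(X.left, U) X.left.functionField a =
      algebraMap (X.left.presheaf.stalk x) X.left.functionField
        (X.left.presheaf.germ U x hx a) :=
  (TopCat.Presheaf.germ_stalkSpecializes_apply (C := CommRingCat) X.left.presheaf hx _ a).symm

theorem scalar_functionField (U : X.left.Opens) [Nonempty U] (c : ℂ) :
    algebraMap Γ(X.left, U) X.left.functionField (algebraMap ℂ Γ(X.left, U) c) =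
      algebraMap ℂ X.left.functionField c :=
  germ_scalar X U _ _ c

/-- The rational 1-forms on `X`. -/
abbrev RatForm (X : CSch) [IsIntegral X.left] : Type :=
  Ω[X.left.functionField⁄ℂ]

/-- The stalk at `x` of `Ω¹(log Δ)`, as a submodule of the rational 1-forms: it is generated by the
regular forms `da` and the forms `df / f`, where `f ≠ 0` divides a local equation of `Δ`. (Used only
at points where `(X, Δ)` is log smooth.) -/
def logFormStalk (i : Δ ⟶ X) (x : X.left) :
    Submodule (X.left.presheaf.stalk x) (RatForm X) :=
  Submodule.span _
    ({ω | ∃ a : X.left.presheaf.stalk x,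
        ω = KaehlerDifferential.D ℂ X.left.functionField (algebraMap _ _ a)} ∪
     {ω | ∃ f : X.left.presheaf.stalk x, f ≠ 0 ∧ idealStalk i x ≤ Ideal.span {f} ∧
        ω = (algebraMap _ X.left.functionField f)⁻¹ •
          KaehlerDifferential.D ℂ X.left.functionField (algebraMap _ _ f)})

/-- `Ω^{[1]}_X(log Δ)(V)` for `V` nonempty: the sections over `V ∩ U` of `Ω¹_U(log Δ|_U)`, where `U` is
the locus at which `(X, Δ)` is log smooth. -/
def logForm (i : Δ ⟶ X) (V : X.left.Opens) [Nonempty V] :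
    Submodule Γ(X.left, V) (RatForm X) where
  carrier := {ω | ∀ x ∈ V, IsLogSmoothAt i x → ω ∈ logFormStalk i x}
  zero_mem' x _ _ := zero_mem _
  add_mem' h h' x hx hs := add_mem (h x hx hs) (h' x hx hs)
  smul_mem' f ω h x hx hs := by
    have := (logFormStalk i x).smul_mem (X.left.presheaf.germ V x hx f) (h x hx hs)
    convert this using 1
    rw [← algebraMap_smul X.left.functionField f ω,
      ← algebraMap_smul X.left.functionField (X.left.presheaf.germ V x hx f) ω]
    congr 1
    exact germ_functionField V x hx f

theorem logForm_mono (i : Δ ⟶ X) {U V : X.left.Opens} [Nonempty U] [Nonempty V] (h : V ≤ U)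
    {ω : RatForm X} (hω : ω ∈ logForm i U) : ω ∈ logForm i V :=
  fun x hx hs => hω x (h hx) hs

/-- The nonempty open subsets of `X`. -/
abbrev NEOpens (X : CSch) : Type := {U : X.left.Opens // Nonempty U}

instance (U : NEOpens X) : Nonempty U.1 := U.2

/-- `H⁰(X, T_X(-log Δ))`, the global sections of `Hom(Ω^{[1]}_X(log Δ), 𝒪_X)`: the families of
`𝒪_X(U)`-linear maps `Ω^{[1]}_X(log Δ)(U) → 𝒪_X(U)` (`U` nonempty) that commute with restriction. -/
def LogVectorField (i : Δ ⟶ X) :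
    Submodule ℂ (∀ U : NEOpens X, logForm i U.1 →ₗ[Γ(X.left, U.1)] Γ(X.left, U.1)) where
  carrier := {φ | ∀ (U V : NEOpens X) (h : V.1 ≤ U.1) (ω : logForm i U.1),
    φ V ⟨ω.1, logForm_mono i h ω.2⟩ = res X h (φ U ω)}
  zero_mem' U V h a := by simp
  add_mem' {δ δ'} hδ hδ' U V h a := by
    simp only [Pi.add_apply, LinearMap.add_apply, map_add, hδ U V h a, hδ' U V h a]
  smul_mem' c δ hδ U V h a := by
    simp only [Pi.smul_apply, LinearMap.smul_apply, hδ U V h a, res_smul]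

/-- The differential `d : 𝒪_X(U) → Ω^{[1]}_X(log Δ)(U)`. -/
def dForm (i : Δ ⟶ X) (U : X.left.Opens) [Nonempty U] (a : Γ(X.left, U)) : logForm i U :=
  ⟨KaehlerDifferential.D ℂ X.left.functionField (algebraMap _ _ a), fun x hx _ =>
    Submodule.subset_span (Or.inl ⟨X.left.presheaf.germ U x hx a, by
      congr 1
      exact germ_functionField U x hx a⟩)⟩

theorem res_dForm (i : Δ ⟶ X) {U V : X.left.Opens} [Nonempty U] [Nonempty V] (h : V ≤ U)
    (a : Γ(X.left, U)) : (dForm i V (res X h a)).1 = (dForm i U a).1 := by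
  change KaehlerDifferential.D ℂ X.left.functionField (algebraMap _ _ _) =
    KaehlerDifferential.D ℂ X.left.functionField (algebraMap _ _ _)
  congr 1
  obtain ⟨x⟩ := ‹Nonempty V›
  rw [germ_functionField V x.1 x.2, germ_functionField U x.1 (h x.2)]
  congr 1
  exact TopCat.Presheaf.germ_res_apply X.left.presheaf (homOfLE h) x.1 x.2 a

/-- The derivation `a ↦ φ(da)` of `𝒪_X(U)` defined by a linear map `φ` on logarithmic forms. -/
def logDerivation (i : Δ ⟶ X) (U : X.left.Opens) [Nonempty U]
    (φ : logForm i U →ₗ[Γ(X.left, U)] Γ(X.left, U)) :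
    Derivation ℂ Γ(X.left, U) Γ(X.left, U) where
  toFun a := φ (dForm i U a)
  map_add' a b := by
    rw [← map_add]
    congr 1
    apply Subtype.ext
    simp [dForm]
  map_smul' c a := by
    rw [RingHom.id_apply, Algebra.smul_def c (φ _), ← smul_eq_mul, ← map_smul]
    congr 1
    apply Subtype.ext
    change KaehlerDifferential.D ℂ X.left.functionField (algebraMap _ _ (c • a)) =
      algebraMap ℂ Γ(X.left, U) c • KaehlerDifferential.D ℂ X.left.functionField (algebraMap _ _ a)
    rw [Algebra.smul_def, map_mul, scalar_functionField, ← Algebra.smul_def, Derivation.map_smul,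
      ← algebraMap_smul X.left.functionField (algebraMap ℂ Γ(X.left, U) c),
      scalar_functionField, algebraMap_smul]
  map_one_eq_zero' := by
    change φ (dForm i U 1) = 0
    rw [← map_zero φ]
    congr 1
    apply Subtype.ext
    simp [dForm]
  leibniz' a b := by
    change φ (dForm i U (a * b)) = a • φ (dForm i U b) + b • φ (dForm i U a)
    rw [← map_smul, ← map_smul, ← map_add]
    congr 1
    apply Subtype.ext
    simp [dForm]

open Classical in
/-- The inclusion `H⁰(X, T_X(-log Δ)) → H⁰(X, T_X)`, dual to `d : 𝒪_X → Ω^{[1]}_X(log Δ)`: it sends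
`φ` to the derivation `a ↦ φ(da)`. -/
def toVectorField (i : Δ ⟶ X) : LogVectorField i →ₗ[ℂ] VectorField X where
  toFun φ := ⟨fun U => if h : Nonempty U then logDerivation i U (φ.1 ⟨U, h⟩) else 0, by
    intro U V h a
    by_cases hV : Nonempty V
    · have hU : Nonempty U := hV.map (fun x => ⟨x.1, h x.2⟩)
      beta_reduce
      rw [dif_pos hV, dif_pos hU]
      change φ.1 ⟨V, hV⟩ (dForm i V (res X h a)) = res X h (φ.1 ⟨U, hU⟩ (dForm i U a))
      rw [← φ.2 ⟨U, hU⟩ ⟨V, hV⟩ h]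
      exact congrArg _ (Subtype.ext (res_dForm i h a))
    · have hV' : V = ⊥ := by
        ext x
        exact ⟨fun hx => (hV ⟨x, hx⟩).elim, fun hx => hx.elim⟩
      subst hV'
      exact Subsingleton.elim _ _⟩
  map_add' φ ψ := by
    apply Subtype.ext
    funext U
    by_cases h : Nonempty U
    · simp only [dif_pos h, Submodule.coe_add, Pi.add_apply]
      rfl
    · simp only [dif_neg h, Submodule.coe_add, Pi.add_apply, add_zero]
  map_smul' c φ := by
    apply Subtype.ext
    funext U
    by_cases h : Nonempty U
    · simp only [dif_pos h, Submodule.coe_smul, Pi.smul_apply, RingHom.id_apply]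
      rfl
    · simp only [dif_neg h, Submodule.coe_smul, Pi.smul_apply, smul_zero, RingHom.id_apply]

end Integral

/-! ### The tangent space of a scheme at a rational point -/

/-- The point of the space underlying `G` given by a `ℂ`-valued point. -/
def pointOf {G : CSch} (p : pt ⟶ G) : G.left :=
  p.left (IsLocalRing.closedPoint ℂ)

/-- The local ring of `G` at a `ℂ`-valued point. -/
abbrev LocalRingAt {G : CSch} (p : pt ⟶ G) : Type :=
  G.left.presheaf.stalk (pointOf p)

/-- The Zariski tangent space `(𝔪 / 𝔪²)^∨` of `G` at a `ℂ`-valued point. -/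
abbrev TangentSpace {G : CSch} (p : pt ⟶ G) : Type :=
  Module.Dual (IsLocalRing.ResidueField (LocalRingAt p)) (IsLocalRing.CotangentSpace (LocalRingAt p))

/-- The `ℂ[ε]`-valued point `f` of `G` is the one given by the tangent vector `v` at `p`: it is
induced by a homomorphism `𝒪_{G,p} → ℂ[ε]` whose restriction to `𝔪` is `a ↦ v(a) ε`. -/
def HasVelocity {G : CSch} (p : pt ⟶ G) (f : dual ⟶ G) (v : TangentSpace p) : Prop :=
  ∃ φ : G.left.presheaf.stalk (pointOf p) ⟶ CommRingCat.of (DualNumber ℂ),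
    f.left = Spec.map φ ≫ G.left.fromSpecStalk (pointOf p) ∧
    ∀ a : IsLocalRing.maximalIdeal (LocalRingAt p), ∃ c : ℂ,
      φ a.1 = c • (DualNumber.eps : DualNumber ℂ) ∧
      algebraMap ℂ (IsLocalRing.ResidueField (LocalRingAt p)) c =
        v (Ideal.toCotangent _ a)

/-- The automorphism of `X_S` over `S` given by an `S`-valued point of a scheme `G` that represents
`A_{X,Δ}`. -/
def pointAut {X Δ : CSch} {i : Δ ⟶ X} {G : CSch}
    (r : (autPairFunctor i).toFunctor.RepresentableBy G) {S : CSch} (f : S ⟶ G) : autOver X S :=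
  (r.homEquiv f).1

/-- The identity point of a scheme `G` that represents `A_{X,Δ}`. -/
def identityPoint {X Δ : CSch} {i : Δ ⟶ X} {G : CSch}
    (r : (autPairFunctor i).toFunctor.RepresentableBy G) : pt ⟶ G :=
  r.homEquiv.symm ⟨(1 : autOver X pt), autPair_one i pt⟩

end LogAut

end

open CategoryTheory MonoidalCategory CartesianMonoidalCategory AlgebraicGeometry Opposite
open scoped KaehlerDifferential

noncomputable section

namespace LogAut

/-! ### Functions on `Y ⊗ Spec ℂ[ε]` -/

/-! A morphism `X ⊗ dual ⟶ X` over `ℂ` that restricts to the identity at `ε = 0` moves no points.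
Since the functions on `U ⊗ dual` are `Γ(U)[ε]` (`dualToSections`), it has the form `a ↦ a + ε ∂a`,
and multiplicativity says that `∂` is a derivation (`exists_deforms`). Conversely every derivation
`∂` of `𝒪_X` gives such a morphism (`deform`), and `1 + ε∂` has inverse `1 - ε∂`. The automorphism
preserves `Δ` over `ℂ[ε]` exactly when `∂` maps the ideal of `Δ` to itself
(`IsOnePlusEps.preservesIdeal`, `IsOnePlusEps.mem_autPair`). Thus the Lie algebra is the space of
ideal-preserving derivations.

It remains to see that these are the logarithmic vector fields. After multiplication by a nonzero
function every rational form is a combination of exact forms, so a logarithmic vector field is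
contraction with its derivation (`algebraMap_logVectorField_apply`); this gives injectivity. By
normality, the local rings at points of codimension at most one are fields or discrete valuation
rings, and the pair is log smooth there. If `∂` preserves the ideal, then `∂f / f` is regular at
these points, so contraction takes logarithmic forms to functions regular in codimension one, hence
regular everywhere (`mem_range_of_height_le_one`). If conversely `φ` is logarithmic and `t` is an
equation of `Δ` near a generic point of `Δ`, then `∂t = t φ(dt/t)`, so the ideal is preserved at
that point; as `Δ` is reduced, its generic points suffice (`toVectorField_preservesIdeal`).

If `G` represents the functor, tangent vectors at `1` are the `ℂ[ε]`-points that reduce to `1`, via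
homomorphisms from the local ring. That sums of tangent vectors correspond to composition is seen
over the square-zero extension with two independent epsilons (`pointAut_dualPoint_add`). -/

/-- The map `A[ε] → B[ε]` induced by `A → B`. -/
def dualNumberMap {A B : Type*} [CommRing A] [CommRing B] (f : A →+* B) :
    DualNumber A →+* DualNumber B where
  toFun x := TrivSqZeroExt.inl (f x.fst) + TrivSqZeroExt.inr (f x.snd)
  map_one' := by ext <;> simp
  map_zero' := by ext <;> simp
  map_add' x y := by ext <;> simp
  map_mul' x y := by ext <;> simp [mul_comm]

@[simp]
theorem fst_dualNumberMap {A B : Type*} [CommRing A] [CommRing B] (f : A →+* B)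
    (x : DualNumber A) : (dualNumberMap f x).fst = f x.fst := by
  simp [dualNumberMap]

@[simp]
theorem snd_dualNumberMap {A B : Type*} [CommRing A] [CommRing B] (f : A →+* B)
    (x : DualNumber A) : (dualNumberMap f x).snd = f x.snd := by
  simp [dualNumberMap]

theorem appLE_algebraMap {X Y : CSch} (f : X ⟶ Y) (U : Y.left.Opens) (V : X.left.Opens)
    (h : V ≤ f.left ⁻¹ᵁ U) (c : ℂ) :
    f.left.appLE U V h (algebraMap ℂ Γ(Y.left, U) c) = algebraMap ℂ Γ(X.left, V) c := by
  change (f.left.appLE U V h).hom (scalar Y U c) = scalar X V c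
  have H : ((Scheme.ΓSpecIso (CommRingCat.of ℂ)).inv ≫ Y.hom.appLE ⊤ U (le_preimage_top Y.hom U)) ≫
      f.left.appLE U V h =
      (Scheme.ΓSpecIso (CommRingCat.of ℂ)).inv ≫ X.hom.appLE ⊤ V (le_preimage_top X.hom V) := by
    rw [Category.assoc, Scheme.Hom.appLE_comp_appLE]
    congr 2
    exact Over.w f
  exact ConcreteCategory.congr_hom H c

theorem app_algebraMap {X Y : CSch} (f : X ⟶ Y) (U : Y.left.Opens) (c : ℂ) :
    f.left.app U (algebraMap ℂ Γ(Y.left, U) c) = algebraMap ℂ _ c := by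
  rw [Scheme.Hom.app_eq_appLE, appLE_algebraMap]

/-- The functions on `Spec ℂ[ε]`. -/
def dualSections : Γ(dual.left, ⊤) ≃+* DualNumber ℂ :=
  (Scheme.ΓSpecIso (CommRingCat.of (DualNumber ℂ))).commRingCatIsoToRingEquiv

theorem epsilon_eq : epsilon = dualSections.symm DualNumber.eps := rfl

theorem dualSections_epsilon : dualSections epsilon = DualNumber.eps := by
  rw [epsilon_eq, RingEquiv.apply_symm_apply]

theorem dualSections_algebraMap (c : ℂ) :
    dualSections (algebraMap ℂ Γ(dual.left, ⊤) c) = TrivSqZeroExt.inl c := by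
  apply dualSections.symm.injective
  rw [RingEquiv.symm_apply_apply]
  have H : (Scheme.ΓSpecIso (CommRingCat.of ℂ)).inv ≫
      dual.hom.appLE ⊤ ⊤ (le_preimage_top dual.hom ⊤) =
      CommRingCat.ofHom (algebraMap ℂ (DualNumber ℂ)) ≫
        (Scheme.ΓSpecIso (CommRingCat.of (DualNumber ℂ))).inv :=
    (Scheme.ΓSpecIso_inv_naturality (CommRingCat.ofHom (algebraMap ℂ (DualNumber ℂ)))).symm ▸
      congrArg _ (Scheme.Hom.appLE_eq_app _)
  exact ConcreteCategory.congr_hom H c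

theorem dualSections_symm_apply (x : DualNumber ℂ) :
    dualSections.symm x = algebraMap ℂ Γ(dual.left, ⊤) x.fst +
      algebraMap ℂ Γ(dual.left, ⊤) x.snd * epsilon := by
  apply dualSections.injective
  rw [RingEquiv.apply_symm_apply, map_add, map_mul, dualSections_algebraMap,
    dualSections_algebraMap, dualSections_epsilon]
  ext <;> simp

theorem epsilon_mul_self : epsilon * epsilon = 0 := by
  apply dualSections.injective
  rw [map_mul, dualSections_epsilon, DualNumber.eps_mul_eps, map_zero]

/-- The projection `Y ⊗ Spec ℂ[ε] ⟶ Y` on schemes. -/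
def pr (Y : CSch) : (Y ⊗ dual).left ⟶ Y.left := (fst Y dual).left

/-- The projection `Y ⊗ Spec ℂ[ε] ⟶ Spec ℂ[ε]` on schemes. -/
def prDual (Y : CSch) : (Y ⊗ dual).left ⟶ dual.left := (snd Y dual).left

theorem isPullback_pr (Y : CSch) : IsPullback (pr Y) (prDual Y) Y.hom dual.hom :=
  IsPullback.of_hasPullback Y.hom dual.hom

/-- The function `ε` on an open subset of `Y ⊗ Spec ℂ[ε]`. -/
def eps (Y : CSch) (W : (Y ⊗ dual).left.Opens) : Γ((Y ⊗ dual).left, W) :=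
  (prDual Y).appLE ⊤ W (le_preimage_top _ _) epsilon

theorem eps_mul_eps (Y : CSch) (W : (Y ⊗ dual).left.Opens) : eps Y W * eps Y W = 0 := by
  unfold eps
  rw [← map_mul, epsilon_mul_self, map_zero]

theorem map_eps (Y : CSch) {W W' : (Y ⊗ dual).left.Opens} (h : W' ≤ W) :
    res (Y ⊗ dual) h (eps Y W) = eps Y W' :=
  ConcreteCategory.congr_hom (Scheme.Hom.appLE_map (prDual Y) _ (homOfLE h).op) epsilon

section Affine

variable (Y : CSch) (U : Y.left.Opens)

/-- Pull-back of functions from `U` to `U ⊗ Spec ℂ[ε]`. -/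
def prMap : Γ(Y.left, U) →+* Γ((Y ⊗ dual).left, pr Y ⁻¹ᵁ U) := ((pr Y).app U).hom

/-- Over affine opens a fibre product of schemes is the spectrum of a tensor product. -/
theorem isPushout_pr (hU : IsAffineOpen U) :
    IsPushout (Y.hom.appLE ⊤ U (le_preimage_top _ _))
      (dual.hom.appLE ⊤ ⊤ (le_preimage_top _ _))
      ((pr Y).appLE U (pr Y ⁻¹ᵁ U) le_rfl)
      ((prDual Y).appLE ⊤ (pr Y ⁻¹ᵁ U) (le_preimage_top _ _)) := by
  have := isIso_pushoutSection_of_isAffineOpen (isPullback_pr Y) (US := ⊤) (UT := ⊤) (UX := U)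
    (UY := pr Y ⁻¹ᵁ U) (le_preimage_top _ _) (le_preimage_top _ _) (by simp)
    (isAffineOpen_top (Spec _)) (isAffineOpen_top (Spec _)) hU
  exact (isIso_pushoutSection_iff ..).1 this

/-- `a + b ε ↦ a + ε b`, from `Γ(Y, U)[ε]` to the functions on `U ⊗ Spec ℂ[ε]`. -/
def dualToSections : DualNumber Γ(Y.left, U) →+* Γ((Y ⊗ dual).left, pr Y ⁻¹ᵁ U) where
  toFun x := prMap Y U x.fst + eps Y _ * prMap Y U x.snd
  map_one' := by simp
  map_zero' := by simp
  map_add' x y := by simp; ring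
  map_mul' x y := by
    have := eps_mul_eps Y (pr Y ⁻¹ᵁ U)
    simp only [TrivSqZeroExt.fst_mul, map_mul, TrivSqZeroExt.snd_mul, smul_eq_mul,
      MulOpposite.smul_eq_mul_unop, MulOpposite.unop_op, map_add]
    linear_combination (-(prMap Y U x.snd * prMap Y U y.snd)) * this

theorem dualToSections_apply (x : DualNumber Γ(Y.left, U)) :
    dualToSections Y U x = prMap Y U x.fst + eps Y _ * prMap Y U x.snd := rfl

/-- The base change `ℂ[ε] → Γ(Y, U)[ε]` of the structure map. -/
def dualScalar : DualNumber ℂ →+* DualNumber Γ(Y.left, U) :=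
  dualNumberMap (algebraMap ℂ Γ(Y.left, U))

theorem dualScalar_apply (x : DualNumber ℂ) :
    dualScalar Y U x = TrivSqZeroExt.inl (algebraMap ℂ Γ(Y.left, U) x.fst) +
      TrivSqZeroExt.inr (algebraMap ℂ Γ(Y.left, U) x.snd) := rfl

theorem prMap_algebraMap (c : ℂ) :
    prMap Y U (algebraMap ℂ _ c) = algebraMap ℂ Γ((Y ⊗ dual).left, pr Y ⁻¹ᵁ U) c :=
  app_algebraMap (fst Y dual) U c

/-- The inverse comes from the universal property of the tensor product, applied to `A → A[ε]` and
`ℂ[ε] → A[ε]`. -/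
theorem exists_sectionsToDual (hU : IsAffineOpen U) :
    ∃ f : Γ((Y ⊗ dual).left, pr Y ⁻¹ᵁ U) →+* DualNumber Γ(Y.left, U),
      f.comp (dualToSections Y U) = RingHom.id _ ∧ (dualToSections Y U).comp f = RingHom.id _ := by
  have P := isPushout_pr Y U hU
  let α : Γ(Y.left, U) ⟶ CommRingCat.of (DualNumber Γ(Y.left, U)) :=
    CommRingCat.ofHom (TrivSqZeroExt.inlHom _ _)
  let β : Γ(dual.left, ⊤) ⟶ CommRingCat.of (DualNumber Γ(Y.left, U)) :=
    CommRingCat.ofHom (R := Γ(dual.left, ⊤)) ((dualScalar Y U).comp dualSections.toRingHom)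
  have hαβ : Y.hom.appLE ⊤ U (le_preimage_top _ _) ≫ α =
      dual.hom.appLE ⊤ ⊤ (le_preimage_top _ _) ≫ β := by
    rw [← cancel_epi (Scheme.ΓSpecIso (CommRingCat.of ℂ)).inv]
    refine ConcreteCategory.hom_ext _ _ fun x => ?_
    change TrivSqZeroExt.inl (algebraMap ℂ Γ(Y.left, U) x) =
      dualScalar Y U (dualSections (algebraMap ℂ Γ(dual.left, ⊤) x))
    rw [dualSections_algebraMap, dualScalar_apply]
    ext <;> simp
  obtain ⟨F, h1, h2⟩ : ∃ F, (pr Y).appLE U (pr Y ⁻¹ᵁ U) le_rfl ≫ F = α ∧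
      (prDual Y).appLE ⊤ (pr Y ⁻¹ᵁ U) (le_preimage_top _ _) ≫ F = β :=
    ⟨P.desc α β hαβ, P.inl_desc _ _ _, P.inr_desc _ _ _⟩
  have h1' : ∀ a, F.hom (prMap Y U a) = TrivSqZeroExt.inl a := fun a => by
    rw [Scheme.Hom.appLE_eq_app] at h1
    exact ConcreteCategory.congr_hom h1 a
  have h2' : ∀ x, F.hom ((prDual Y).appLE ⊤ _ (le_preimage_top _ _) x) =
      dualScalar Y U (dualSections x) := fun x =>
    ConcreteCategory.congr_hom h2 x
  have h2e : F.hom (eps Y _) = DualNumber.eps := by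
    refine (h2' epsilon).trans ?_
    rw [dualSections_epsilon, dualScalar_apply]
    ext <;> simp
  refine ⟨F.hom, ?_, ?_⟩
  · refine RingHom.ext fun x => ?_
    rw [RingHom.comp_apply, dualToSections_apply, map_add, map_mul, h1', h1', h2e]
    ext <;> simp
  -- The two maps into a pushout are jointly epimorphic, so it is enough to test on functions pulled
  -- back from `U` and from `Spec ℂ[ε]`.
  · have key : F ≫ CommRingCat.ofHom (dualToSections Y U) = 𝟙 _ := by
      apply P.hom_ext
      · refine ConcreteCategory.hom_ext _ _ fun x => ?_
        rw [Scheme.Hom.appLE_eq_app]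
        change dualToSections Y U (F.hom (prMap Y U x)) = prMap Y U x
        rw [h1', dualToSections_apply]
        simp
      · refine ConcreteCategory.hom_ext _ _ fun x => ?_
        obtain ⟨x, rfl⟩ := dualSections.symm.surjective x
        have hc : ∀ c, ((prDual Y).appLE ⊤ (pr Y ⁻¹ᵁ U) (le_preimage_top _ _)).hom
            (algebraMap ℂ Γ(dual.left, ⊤) c) = prMap Y U (algebraMap ℂ _ c) := fun c =>
          (appLE_algebraMap (snd Y dual) ⊤ _ _ c).trans (prMap_algebraMap Y U c).symm
        change dualToSections Y U (F.hom ((prDual Y).appLE ⊤ _ (le_preimage_top _ _) _)) =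
          ((prDual Y).appLE ⊤ (pr Y ⁻¹ᵁ U) (le_preimage_top _ _)).hom (dualSections.symm x)
        rw [h2', RingEquiv.apply_symm_apply, dualSections_symm_apply, map_add, map_mul, hc, hc,
          dualToSections_apply, dualScalar_apply, mul_comm]
        simp only [TrivSqZeroExt.fst_add, TrivSqZeroExt.fst_inl, TrivSqZeroExt.fst_inr, add_zero,
          TrivSqZeroExt.snd_add, TrivSqZeroExt.snd_inl, TrivSqZeroExt.snd_inr, zero_add]
        rfl
    exact congrArg CommRingCat.Hom.hom key

theorem dualToSections_bijective_of_isAffineOpen (hU : IsAffineOpen U) :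
    Function.Bijective (dualToSections Y U) := by
  obtain ⟨f, h1, h2⟩ := exists_sectionsToDual Y U hU
  exact Function.bijective_iff_has_inverse.2
    ⟨f, fun x => RingHom.congr_fun h1 x, fun x => RingHom.congr_fun h2 x⟩

end Affine

theorem prMap_res (Y : CSch) {U V : Y.left.Opens} (h : V ≤ U) (a : Γ(Y.left, U)) :
    prMap Y V (res Y h a) =
      res (Y ⊗ dual) (show pr Y ⁻¹ᵁ V ≤ pr Y ⁻¹ᵁ U from fun _ hx => h hx) (prMap Y U a) :=
  ConcreteCategory.congr_hom ((pr Y).naturality (homOfLE h).op) a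

theorem dualToSections_res (Y : CSch) {U V : Y.left.Opens} (h : V ≤ U)
    (x : DualNumber Γ(Y.left, U)) :
    dualToSections Y V (dualNumberMap (res Y h) x) =
      res (Y ⊗ dual) (show pr Y ⁻¹ᵁ V ≤ pr Y ⁻¹ᵁ U from fun _ hx => h hx)
        (dualToSections Y U x) := by
  rw [dualToSections_apply, dualToSections_apply, map_add, map_mul, map_eps, ← prMap_res,
    ← prMap_res, fst_dualNumberMap, snd_dualNumberMap]

theorem exists_affine_nhd (Y : Scheme) (U : Y.Opens) (x : U) :
    ∃ V : Y.Opens, IsAffineOpen V ∧ x.1 ∈ V ∧ V ≤ U := by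
  obtain ⟨_, ⟨V, hV, rfl⟩, hx, hVU⟩ :=
    Y.isBasis_affineOpens.exists_subset_of_mem_open x.2 U.isOpen
  exact ⟨V, hV, hx, hVU⟩

/-- A function on `U` vanishes if it vanishes on a neighbourhood of every point. -/
theorem eq_zero_of_locally (Y : CSch) {ι : Type*} (U : Y.left.Opens) (V : ι → Y.left.Opens)
    (hV : ∀ i, V i ≤ U) (hc : U ≤ iSup V) (s : Γ(Y.left, U)) (hs : ∀ i, res Y (hV i) s = 0) :
    s = 0 :=
  Y.left.sheaf.eq_of_locally_eq' V U (fun i => homOfLE (hV i)) hc s 0 fun i => by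
    rw [map_zero]
    exact hs i

theorem le_iSup_of_mem {Y : Scheme} (U : Y.Opens) (V : U → Y.Opens) (hx : ∀ x : U, x.1 ∈ V x) :
    U ≤ iSup V := fun x hxU =>
  (TopologicalSpace.Opens.mem_iSup).2 ⟨⟨x, hxU⟩, hx ⟨x, hxU⟩⟩

theorem dualToSections_injective (Y : CSch) (U : Y.left.Opens) :
    Function.Injective (dualToSections Y U) := by
  rw [injective_iff_map_eq_zero]
  intro x hx
  choose V hV hxV hVU using exists_affine_nhd Y.left U
  have key : ∀ i, dualNumberMap (res Y (hVU i)) x = 0 := fun i => by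
    apply (dualToSections_bijective_of_isAffineOpen Y _ (hV i)).1
    rw [dualToSections_res, hx, map_zero, map_zero]
  ext
  · refine eq_zero_of_locally Y U V hVU (le_iSup_of_mem U V hxV) _ fun i => ?_
    simpa using congrArg TrivSqZeroExt.fst (key i)
  · refine eq_zero_of_locally Y U V hVU (le_iSup_of_mem U V hxV) _ fun i => ?_
    simpa using congrArg TrivSqZeroExt.snd (key i)

theorem res_res (Y : CSch) {U V W : Y.left.Opens} (h : V ≤ U) (h' : W ≤ V) (a : Γ(Y.left, U)) :
    res Y h' (res Y h a) = res Y (h'.trans h) a := by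
  rw [← CommRingCat.comp_apply, ← Functor.map_comp]
  rfl

/-- Compatible functions on a cover of `U` glue. -/
theorem exists_glue (Y : CSch) {ι : Type} (U : Y.left.Opens) (V : ι → Y.left.Opens)
    (hV : ∀ i, V i ≤ U) (hc : U ≤ iSup V) (s : ∀ i, Γ(Y.left, V i))
    (hs : ∀ i j, res Y (inf_le_left : V i ⊓ V j ≤ V i) (s i) =
      res Y (inf_le_right : V i ⊓ V j ≤ V j) (s j)) :
    ∃ t : Γ(Y.left, U), ∀ i, res Y (hV i) t = s i := by
  obtain ⟨t, ht, -⟩ := Y.left.sheaf.existsUnique_gluing' V U (fun i => homOfLE (hV i)) hc s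
    fun i j => hs i j
  exact ⟨t, ht⟩

/-- Preimages exist on affine opens. They agree on overlaps because injectivity holds over every
open set, affine or not, so both coefficients glue. -/
theorem dualToSections_surjective (Y : CSch) (U : Y.left.Opens) :
    Function.Surjective (dualToSections Y U) := by
  intro g
  choose V hV hxV hVU using exists_affine_nhd Y.left U
  have hp : ∀ {W W' : Y.left.Opens}, W ≤ W' → pr Y ⁻¹ᵁ W ≤ pr Y ⁻¹ᵁ W' := fun h _ hx => h hx
  choose t ht using fun i => (dualToSections_bijective_of_isAffineOpen Y _ (hV i)).2
    (res (Y ⊗ dual) (hp (hVU i)) g)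
  have hcomp : ∀ i j, dualNumberMap (res Y (inf_le_left : V i ⊓ V j ≤ V i)) (t i) =
      dualNumberMap (res Y (inf_le_right : V i ⊓ V j ≤ V j)) (t j) := fun i j => by
    apply dualToSections_injective
    rw [dualToSections_res, dualToSections_res, ht, ht, res_res, res_res]
  have hcov := le_iSup_of_mem U V hxV
  obtain ⟨a, ha⟩ := exists_glue Y U V hVU hcov (fun i => (t i).fst) fun i j => by
    simpa using congrArg TrivSqZeroExt.fst (hcomp i j)
  obtain ⟨b, hb⟩ := exists_glue Y U V hVU hcov (fun i => (t i).snd) fun i j => by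
    simpa using congrArg TrivSqZeroExt.snd (hcomp i j)
  refine ⟨TrivSqZeroExt.inl a + TrivSqZeroExt.inr b, sub_eq_zero.1 ?_⟩
  refine eq_zero_of_locally (Y ⊗ dual) (pr Y ⁻¹ᵁ U) (fun i => pr Y ⁻¹ᵁ V i)
    (fun i => hp (hVU i)) ?_ _ fun i => ?_
  · intro x hx
    exact (TopologicalSpace.Opens.mem_iSup).2 ⟨⟨_, hx⟩, hxV ⟨_, hx⟩⟩
  · rw [map_sub, ← dualToSections_res, ← ht i, sub_eq_zero]
    congr 1
    ext
    · simpa using ha i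
    · simpa using hb i

/-! ### The zero section -/

/-- The structure morphism of `Y`. -/
def toPt (Y : CSch) : Y ⟶ pt := Over.homMk Y.hom

/-- The section of `Y ⊗ Spec ℂ[ε] ⟶ Y` at `ε = 0`. -/
def zeroSec (Y : CSch) : Y ⟶ Y ⊗ dual := lift (𝟙 Y) (toPt Y ≫ dualZero)

theorem zeroSec_fst (Y : CSch) : zeroSec Y ≫ fst Y dual = 𝟙 Y := lift_fst _ _

theorem zeroSec_snd (Y : CSch) : zeroSec Y ≫ snd Y dual = toPt Y ≫ dualZero := lift_snd _ _

theorem zeroSec_left_pr (Y : CSch) : (zeroSec Y).left ≫ pr Y = 𝟙 Y.left :=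
  congrArg CommaMorphism.left (zeroSec_fst Y)

theorem zeroSec_left_prDual (Y : CSch) : (zeroSec Y).left ≫ prDual Y = Y.hom ≫ dualZero.left :=
  congrArg CommaMorphism.left (zeroSec_snd Y)

/-- Every non-unit of `ℂ[ε]` squares to zero and so lies in every prime. -/
theorem subsingleton_dual : Subsingleton dual.left := by
  change Subsingleton (PrimeSpectrum (DualNumber ℂ))
  refine ⟨fun x y => ?_⟩
  have : ∀ x : PrimeSpectrum (DualNumber ℂ), x.asIdeal = IsLocalRing.maximalIdeal _ := fun x => by
    refine le_antisymm (IsLocalRing.le_maximalIdeal x.2.ne_top) fun r hr => ?_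
    refine x.2.mem_of_pow_mem 2 ?_
    have h0 : r.fst = 0 := by
      by_contra h
      exact (IsLocalRing.mem_maximalIdeal r).1 hr
        (TrivSqZeroExt.isUnit_iff_isUnit_fst.2 (isUnit_iff_ne_zero.2 h))
    have : r ^ 2 = 0 := by rw [sq]; ext <;> simp [h0]
    rw [this]
    exact x.asIdeal.zero_mem
  exact PrimeSpectrum.ext ((this x).trans (this y).symm)

/-- By pasting of pullback squares, the zero section is a base change of `dualZero`, which is
surjective because `Spec ℂ[ε]` has one point. Consequently open subsets of `Y ⊗ dual` can be
compared on the zero section. -/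
theorem zeroSec_surjective (Y : CSch) : Function.Surjective (zeroSec Y).left := by
  have P : IsPullback (zeroSec Y).left Y.hom (prDual Y) dualZero.left := by
    refine IsPullback.of_right (h₁₂ := pr Y) (v₁₃ := Y.hom) (h₂₂ := dual.hom) ?_
      (zeroSec_left_prDual Y) (isPullback_pr Y)
    rw [zeroSec_left_pr, show dualZero.left ≫ dual.hom = 𝟙 _ from Over.w dualZero]
    have : IsIso (𝟙 pt.left) := inferInstanceAs (IsIso (𝟙 (Spec (CommRingCat.of ℂ))))
    exact IsPullback.of_horiz_isIso
      ⟨(Category.id_comp Y.hom).trans (Category.comp_id Y.hom).symm⟩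
  have h1 : Surjective dualZero.left := ⟨fun x =>
    ⟨IsLocalRing.closedPoint ℂ, subsingleton_dual.elim _ _⟩⟩
  exact (MorphismProperty.of_isPullback (P := @Surjective) P.flip h1).surj

/-! ### Morphisms of the form `a ↦ a + ε ∂(a)` -/

/-- The ring homomorphism `a ↦ a + ε d(a)` given by a derivation. -/
def expDerivation {A : Type*} [CommRing A] [Algebra ℂ A] (d : Derivation ℂ A A) :
    A →+* DualNumber A where
  toFun a := TrivSqZeroExt.inl a + TrivSqZeroExt.inr (d a)
  map_one' := by ext <;> simp
  map_zero' := by ext <;> simp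
  map_add' x y := by ext <;> simp
  map_mul' x y := by ext <;> simp [mul_comm]

@[simp]
theorem fst_expDerivation {A : Type*} [CommRing A] [Algebra ℂ A] (d : Derivation ℂ A A) (a : A) :
    (expDerivation d a).fst = a := by simp [expDerivation]

@[simp]
theorem snd_expDerivation {A : Type*} [CommRing A] [Algebra ℂ A] (d : Derivation ℂ A A) (a : A) :
    (expDerivation d a).snd = d a := by simp [expDerivation]

/-- The morphism `q` is `a ↦ a + ε δ(a)`, and agrees with the projection on the spaces. -/
def Deforms {X : CSch} (q : (X ⊗ dual).left ⟶ X.left) (δ : VectorField X) : Prop :=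
  ∀ U : X.left.Opens, ∃ h : q ⁻¹ᵁ U = pr X ⁻¹ᵁ U, ∀ a : Γ(X.left, U),
    q.appLE U (pr X ⁻¹ᵁ U) h.ge a = prMap X U a + eps X _ * prMap X U (δ.1 U a)

/-- The ring homomorphism `a ↦ a + ε δ(a)` on the functions on `U`. -/
def deformRingHom {X : CSch} (δ : VectorField X) (U : X.left.Opens) :
    Γ(X.left, U) →+* Γ((X ⊗ dual).left, pr X ⁻¹ᵁ U) :=
  (dualToSections X U).comp (expDerivation (δ.1 U))

theorem deformRingHom_apply {X : CSch} (δ : VectorField X) (U : X.left.Opens) (a : Γ(X.left, U)) :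
    deformRingHom δ U a = prMap X U a + eps X _ * prMap X U (δ.1 U a) := by
  rw [deformRingHom, RingHom.comp_apply, dualToSections_apply, fst_expDerivation,
    snd_expDerivation]

theorem deformRingHom_res {X : CSch} (δ : VectorField X) {U V : X.left.Opens} (h : V ≤ U)
    (a : Γ(X.left, U)) : deformRingHom δ V (res X h a) =
      res (X ⊗ dual) (show pr X ⁻¹ᵁ V ≤ pr X ⁻¹ᵁ U from fun _ hx => h hx)
        (deformRingHom δ U a) := by
  rw [deformRingHom_apply, deformRingHom_apply, map_add, map_mul, map_eps, ← prMap_res,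
    ← prMap_res, δ.2]

/-- The sheaf map `a ↦ a + ε δ(a)`. -/
def deformSheafMap {X : CSch} (δ : VectorField X) :
    X.left.presheaf ⟶ (TopCat.Presheaf.pushforward _ (pr X).base).obj (X ⊗ dual).left.presheaf where
  app U := CommRingCat.ofHom (deformRingHom δ U.unop)
  naturality U V i := by
    refine ConcreteCategory.hom_ext _ _ fun a => ?_
    exact deformRingHom_res δ i.unop.le a

/-- A unit stays a unit after subtracting a nilpotent. -/
theorem isUnit_of_isUnit_add {A : Type*} [CommRing A] {u n : A} (hn : n * n = 0)
    (h : IsUnit (u + n)) : IsUnit u := by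
  have : IsNilpotent (-n) := ⟨2, by rw [sq]; simpa using hn⟩
  simpa using this.isUnit_add_left_of_commute h (Commute.all _ _)

/-- The morphism of ringed spaces `a ↦ a + ε δ(a)`. -/
def deformHom {X : CSch} (δ : VectorField X) :
    (X ⊗ dual).left.toPresheafedSpace ⟶ X.left.toPresheafedSpace :=
  ⟨(pr X).base, deformSheafMap δ⟩

theorem germ_stalkMap_deformHom {X : CSch} (δ : VectorField X) (x : (X ⊗ dual).left)
    (U : X.left.Opens) (hx : pr X x ∈ U) (s : Γ(X.left, U)) :
    (PresheafedSpace.Hom.stalkMap (deformHom δ) x).hom (X.left.presheaf.germ U (pr X x) hx s) =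
      (X ⊗ dual).left.presheaf.germ (pr X ⁻¹ᵁ U) x hx (deformRingHom δ U s) :=
  ConcreteCategory.congr_hom (PresheafedSpace.stalkMap_germ (deformHom δ) U x hx) s

/-- On stalks the map differs from that of the projection by a multiple of `ε`, which is nilpotent;
the projection is local. -/
theorem isLocalHom_stalkMap_deformHom {X : CSch} (δ : VectorField X) (x : (X ⊗ dual).left) :
    IsLocalHom (PresheafedSpace.Hom.stalkMap (deformHom δ) x).hom := by
  refine ⟨fun t ht => ?_⟩
  obtain ⟨U, hx, s, rfl⟩ := TopCat.Presheaf.exists_germ_eq X.left.presheaf (x := pr X x) t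
  rw [germ_stalkMap_deformHom δ x U hx s, deformRingHom_apply, map_add] at ht
  have h2 := isUnit_of_isUnit_add (by
    rw [← map_mul, mul_mul_mul_comm, eps_mul_eps, zero_mul, map_zero]) ht
  have e2 : (pr X).stalkMap x (X.left.presheaf.germ U (pr X x) hx s) =
      (X ⊗ dual).left.presheaf.germ (pr X ⁻¹ᵁ U) x hx (prMap X U s) :=
    ConcreteCategory.congr_hom ((pr X).germ_stalkMap U x hx) s
  have : IsLocalHom ((pr X).stalkMap x).hom := inferInstance
  refine this.map_nonunit _ ?_
  erw [e2]
  exact h2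

/-- The morphism `a ↦ a + ε δ(a)`. -/
def deform {X : CSch} (δ : VectorField X) : (X ⊗ dual).left ⟶ X.left :=
  ⟨⟨deformHom δ, isLocalHom_stalkMap_deformHom δ⟩⟩

theorem deform_deforms {X : CSch} (δ : VectorField X) : Deforms (deform δ) δ := fun U =>
  ⟨rfl, fun a => (ConcreteCategory.congr_hom (Scheme.Hom.appLE_eq_app (deform δ)) a).trans
    (deformRingHom_apply δ U a)⟩

/-- The space of a scheme is T0, so a continuous map to it is determined by the preimages of open
sets. -/
theorem Deforms.ext {X : CSch} {q q' : (X ⊗ dual).left ⟶ X.left} {δ : VectorField X}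
    (h : Deforms q δ) (h' : Deforms q' δ) : q = q' := by
  have hb : q.base = q'.base := by
    ext x
    refine (Specializes.antisymm ?_ ?_).eq <;> refine specializes_iff_forall_open.2 fun U hU hx => ?_
    · exact (((h ⟨U, hU⟩).1.trans (h' ⟨U, hU⟩).1.symm).ge : _) hx
    · exact (((h ⟨U, hU⟩).1.trans (h' ⟨U, hU⟩).1.symm).le : _) hx
  refine Scheme.Hom.ext hb fun U => ?_
  obtain ⟨h1, h2⟩ := h U
  obtain ⟨h1', h2'⟩ := h' U
  have key : q.appLE U (pr X ⁻¹ᵁ U) h1.ge = q'.appLE U (pr X ⁻¹ᵁ U) h1'.ge :=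
    ConcreteCategory.hom_ext _ _ fun a => (h2 a).trans (h2' a).symm
  have e : q.appLE U (q' ⁻¹ᵁ U) (h1.trans h1'.symm).ge = q'.appLE U (q' ⁻¹ᵁ U) le_rfl := by
    have h3 : q' ⁻¹ᵁ U ≤ pr X ⁻¹ᵁ U := h1'.le
    rw [← Scheme.Hom.appLE_map q h1.ge (homOfLE h3).op,
      ← Scheme.Hom.appLE_map q' h1'.ge (homOfLE h3).op, key]
  rw [Scheme.Hom.appLE_eq_app] at e
  rw [← e, Scheme.Hom.appLE]
  rfl

/-- The value of a morphism `a ↦ a + ε δ(a)` on the functions on `U`. -/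
theorem Deforms.comp_hom {X : CSch} {q : (X ⊗ dual).left ⟶ X.left} {δ : VectorField X}
    (h : Deforms q δ) : q ≫ X.hom = (X ⊗ dual).hom := by
  refine ext_of_isAffine (Y := Spec (CommRingCat.of ℂ)) ?_
  rw [← cancel_epi (Scheme.ΓSpecIso (CommRingCat.of ℂ)).inv]
  refine ConcreteCategory.hom_ext _ _ fun c => ?_
  obtain ⟨h1, h2⟩ := h ⊤
  have h3 := h2 (algebraMap ℂ _ c)
  -- A morphism to `Spec ℂ` is determined by its effect on constants, and a `ℂ`-derivation kills
  -- them.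
  rw [Derivation.map_algebraMap, map_zero, mul_zero, add_zero, prMap_algebraMap] at h3
  have e1 : (q ≫ X.hom).appTop = X.hom.appLE ⊤ ⊤ (le_preimage_top _ _) ≫
      q.appLE ⊤ (pr X ⁻¹ᵁ ⊤) h1.ge := by
    rw [Scheme.Hom.appLE_comp_appLE]
    exact (Scheme.Hom.appLE_eq_app _).symm
  have e2 : (X ⊗ dual).hom.appTop = (X ⊗ dual).hom.appLE ⊤ ⊤ (le_preimage_top _ _) :=
    (Scheme.Hom.appLE_eq_app _).symm
  rw [e1, e2]
  exact h3

/-! ### Infinitesimal automorphisms and derivations -/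

theorem dualZero_epsilon : dualZero.left.appLE ⊤ ⊤ (le_preimage_top _ _) epsilon = 0 := by
  have H : (Scheme.ΓSpecIso (CommRingCat.of (DualNumber ℂ))).inv ≫
      dualZero.left.appLE ⊤ ⊤ (le_preimage_top _ _) =
      CommRingCat.ofHom (TrivSqZeroExt.fstHom ℂ ℂ ℂ).toRingHom ≫
        (Scheme.ΓSpecIso (CommRingCat.of ℂ)).inv :=
    (Scheme.ΓSpecIso_inv_naturality
      (CommRingCat.ofHom (TrivSqZeroExt.fstHom ℂ ℂ ℂ).toRingHom)).symm ▸
      congrArg _ (Scheme.Hom.appLE_eq_app _)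
  refine (ConcreteCategory.congr_hom H DualNumber.eps).trans ?_
  change (Scheme.ΓSpecIso (CommRingCat.of ℂ)).inv.hom 0 = 0
  exact map_zero _

theorem dualScale_epsilon (c : ℂ) :
    (dualScale c).left.appLE ⊤ ⊤ (le_preimage_top _ _) epsilon =
      algebraMap ℂ Γ(dual.left, ⊤) c * epsilon := by
  have H : (Scheme.ΓSpecIso (CommRingCat.of (DualNumber ℂ))).inv ≫
      (dualScale c).left.appLE ⊤ ⊤ (le_preimage_top _ _) =
      CommRingCat.ofHom (TrivSqZeroExt.map (c • (LinearMap.id : ℂ →ₗ[ℂ] ℂ))).toRingHom ≫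
        (Scheme.ΓSpecIso (CommRingCat.of (DualNumber ℂ))).inv :=
    (Scheme.ΓSpecIso_inv_naturality
      (CommRingCat.ofHom (TrivSqZeroExt.map (c • (LinearMap.id : ℂ →ₗ[ℂ] ℂ))).toRingHom)).symm ▸
      congrArg _ (Scheme.Hom.appLE_eq_app _)
  refine (ConcreteCategory.congr_hom H DualNumber.eps).trans ?_
  change dualSections.symm
    (TrivSqZeroExt.map (c • (LinearMap.id : ℂ →ₗ[ℂ] ℂ)) DualNumber.eps) = _
  have : TrivSqZeroExt.map (c • (LinearMap.id : ℂ →ₗ[ℂ] ℂ)) DualNumber.eps =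
      TrivSqZeroExt.inr c := (TrivSqZeroExt.map_inr _ _).trans (by simp)
  rw [this, dualSections_symm_apply, TrivSqZeroExt.fst_inr, TrivSqZeroExt.snd_inr, map_zero,
    zero_add]

/-- The effect on functions of `u ≫ q`, where `q` is `a ↦ a + ε δ(a)`. -/
theorem Deforms.comp_appLE {X : CSch} {q : (X ⊗ dual).left ⟶ X.left} {δ : VectorField X}
    (hq : Deforms q δ) {Z : Scheme} (u : Z ⟶ (X ⊗ dual).left) (U : X.left.Opens) (W : Z.Opens)
    (h : W ≤ (u ≫ pr X) ⁻¹ᵁ U) (h' : W ≤ (u ≫ q) ⁻¹ᵁ U) (a : Γ(X.left, U)) :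
    (u ≫ q).appLE U W h' a = (u ≫ pr X).appLE U W h a +
      (u ≫ prDual X).appLE ⊤ W (le_preimage_top _ _) epsilon *
        (u ≫ pr X).appLE U W h (δ.1 U a) := by
  obtain ⟨h1, h2⟩ := hq U
  have h3 : W ≤ u ⁻¹ᵁ (pr X ⁻¹ᵁ U) := h
  have e1 := ConcreteCategory.congr_hom
    (Scheme.Hom.appLE_comp_appLE u q U (pr X ⁻¹ᵁ U) W h1.ge h3) a
  have e2 : ∀ b, (u ≫ pr X).appLE U W h b = u.appLE (pr X ⁻¹ᵁ U) W h3 (prMap X U b) := fun b => by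
    have := ConcreteCategory.congr_hom
      (Scheme.Hom.appLE_comp_appLE u (pr X) U (pr X ⁻¹ᵁ U) W le_rfl h3) b
    rw [Scheme.Hom.appLE_eq_app] at this
    exact this.symm
  have e3 : (u ≫ prDual X).appLE ⊤ W (le_preimage_top _ _) epsilon =
      u.appLE (pr X ⁻¹ᵁ U) W h3 (eps X _) :=
    (ConcreteCategory.congr_hom (Scheme.Hom.appLE_comp_appLE u (prDual X) ⊤ (pr X ⁻¹ᵁ U) W
      (le_preimage_top _ _) h3) epsilon).symm
  rw [e2, e2, e3, ← map_mul, ← map_add]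
  exact e1.symm.trans (congrArg (u.appLE (pr X ⁻¹ᵁ U) W h3).hom (h2 a))

theorem Deforms.preimage {X : CSch} {q : (X ⊗ dual).left ⟶ X.left} {δ : VectorField X}
    (hq : Deforms q δ) (U : X.left.Opens) : q ⁻¹ᵁ U = pr X ⁻¹ᵁ U := (hq U).1

theorem pt_hom_ext {Y : CSch} (f g : Y ⟶ pt) : f = g :=
  Over.OverMorphism.ext (((Category.comp_id _).symm.trans (Over.w f)).trans
    ((Category.comp_id _).symm.trans (Over.w g)).symm)

theorem whisker_dualZero (X : CSch) : X ◁ dualZero = fst X pt ≫ zeroSec X := by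
  apply CartesianMonoidalCategory.hom_ext
  · rw [Category.assoc, zeroSec_fst]
    simp
  · rw [Category.assoc, zeroSec_snd, ← Category.assoc, whiskerLeft_snd]
    congr 1
    exact pt_hom_ext _ _

/-- Reduction modulo `ε` is restriction to the zero section; only the component in `X` matters, the
other being fixed. -/
theorem autBaseChange_dualZero_eq_one_iff {X : CSch} (σ : autOver X dual) :
    autBaseChange X dualZero σ = 1 ↔ zeroSec X ≫ σ.1.hom ≫ fst X dual = 𝟙 X := by
  have key : autBaseChange X dualZero σ = 1 ↔ baseChange X dualZero σ.1.hom = 𝟙 _ :=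
    ⟨fun h => congrArg (fun τ => τ.1.hom) h, fun h => Subtype.ext (Iso.ext h)⟩
  rw [key, baseChange, whisker_dualZero]
  constructor
  · intro h
    have h2 := congrArg (lift (𝟙 X) (toPt X) ≫ · ≫ fst X pt) h
    simpa using h2
  · intro h
    apply CartesianMonoidalCategory.hom_ext <;> simp [h]

/-! ### Retractions onto the zero section -/

section OfRetraction

variable {X : CSch} (q : (X ⊗ dual).left ⟶ X.left)

/-- Both `q` and the projection are left inverse to the zero section, which is surjective, so they
agree on points. -/
theorem preimage_eq_of_zeroSec_comp (h : (zeroSec X).left ≫ q = 𝟙 _) (U : X.left.Opens) :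
    q ⁻¹ᵁ U = pr X ⁻¹ᵁ U := by
  ext x
  obtain ⟨y, rfl⟩ := zeroSec_surjective X x
  change q ((zeroSec X).left y) ∈ U ↔ pr X ((zeroSec X).left y) ∈ U
  rw [← Scheme.Hom.comp_apply, ← Scheme.Hom.comp_apply, h, zeroSec_left_pr]

/-- Restriction of functions to the zero section. -/
def zeroSecMap (X : CSch) (U : X.left.Opens) : Γ((X ⊗ dual).left, pr X ⁻¹ᵁ U) →+* Γ(X.left, U) :=
  ((zeroSec X).left.appLE (pr X ⁻¹ᵁ U) U (fun x hx => by
    change ((zeroSec X).left ≫ pr X) x ∈ U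
    rw [zeroSec_left_pr]
    exact hx)).hom

theorem appLE_id {Y : Scheme} (f : Y ⟶ Y) (hf : f = 𝟙 Y) (U : Y.Opens) (h : U ≤ f ⁻¹ᵁ U)
    (a : Γ(Y, U)) : f.appLE U U h a = a := by
  subst hf
  exact ConcreteCategory.congr_hom (Scheme.Hom.appLE_eq_app (𝟙 Y)) a

theorem zeroSecMap_of_comp (h : (zeroSec X).left ≫ q = 𝟙 _) (U : X.left.Opens) (hU)
    (a : Γ(X.left, U)) : zeroSecMap X U (q.appLE U (pr X ⁻¹ᵁ U) hU a) = a :=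
  (ConcreteCategory.congr_hom (Scheme.Hom.appLE_comp_appLE (zeroSec X).left q U _ U hU _) a).trans
    (appLE_id _ h _ _ _)

theorem zeroSecMap_prMap (U : X.left.Opens) (a : Γ(X.left, U)) :
    zeroSecMap X U (prMap X U a) = a := by
  have := zeroSecMap_of_comp (pr X) (zeroSec_left_pr X) U le_rfl a
  rwa [Scheme.Hom.appLE_eq_app] at this

theorem zeroSecMap_eps (U : X.left.Opens) : zeroSecMap X U (eps X _) = 0 := by
  have h1 : U ≤ (zeroSec X).left ⁻¹ᵁ (pr X ⁻¹ᵁ U) := fun x hx => by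
    change ((zeroSec X).left ≫ pr X) x ∈ U
    rw [zeroSec_left_pr]
    exact hx
  have e1 : zeroSecMap X U (eps X _) =
      ((zeroSec X).left ≫ prDual X).appLE ⊤ U (le_preimage_top _ _) epsilon :=
    ConcreteCategory.congr_hom (Scheme.Hom.appLE_comp_appLE (zeroSec X).left (prDual X) ⊤ _ U
      (le_preimage_top _ _) h1) epsilon
  have e2 : (Y : Scheme) → (f g : X.left ⟶ dual.left) → f = g →
      f.appLE ⊤ U (le_preimage_top _ _) epsilon = g.appLE ⊤ U (le_preimage_top _ _) epsilon := by
    rintro - f g rfl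
    rfl
  rw [e1, e2 X.left _ _ (zeroSec_left_prDual X)]
  refine (ConcreteCategory.congr_hom (Scheme.Hom.appLE_comp_appLE X.hom dualZero.left ⊤ ⊤ U
    (le_preimage_top _ _) (le_preimage_top _ _)) epsilon).symm.trans ?_
  refine (congrArg (X.hom.appLE ⊤ U (le_preimage_top _ _)).hom dualZero_epsilon).trans ?_
  exact map_zero _

theorem zeroSecMap_dualToSections (U : X.left.Opens) (x : DualNumber Γ(X.left, U)) :
    zeroSecMap X U (dualToSections X U x) = x.fst := by
  rw [dualToSections_apply, map_add, map_mul, zeroSecMap_eps, zero_mul, add_zero, zeroSecMap_prMap]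

/-- The derivation given by a section of `A[ε] → A`. -/
def derivationOfSection {A : Type*} [CommRing A] [Algebra ℂ A] (F : A →+* DualNumber A)
    (h : ∀ a, (F a).fst = a) (hc : ∀ c : ℂ, (F (algebraMap ℂ A c)).snd = 0) :
    Derivation ℂ A A where
  toFun a := (F a).snd
  map_add' a b := by simp
  map_smul' c a := by
    rw [Algebra.smul_def, map_mul, TrivSqZeroExt.snd_mul, hc, h, h, RingHom.id_apply,
      Algebra.smul_def]
    simp [Algebra.smul_def]
  map_one_eq_zero' := by simp
  leibniz' a b := by simp [h, mul_comm]

/-- A morphism over `ℂ` that restricts to the identity of the zero section is of the form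
`a ↦ a + ε δ(a)`. -/
theorem exists_deforms (h : (zeroSec X).left ≫ q = 𝟙 _) (hq : q ≫ X.hom = (X ⊗ dual).hom) :
    ∃ δ : VectorField X, Deforms q δ := by
  have hU := preimage_eq_of_zeroSec_comp q h
  let E : ∀ U : X.left.Opens, DualNumber Γ(X.left, U) ≃+* Γ((X ⊗ dual).left, pr X ⁻¹ᵁ U) :=
    fun U => RingEquiv.ofBijective (dualToSections X U)
      ⟨dualToSections_injective X U, dualToSections_surjective X U⟩
  -- The coefficients of `q` on functions. Restriction to the zero section shows that the constant
  -- coefficient is the identity, so the coefficient of `ε` is a derivation.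
  let F : ∀ U : X.left.Opens, Γ(X.left, U) →+* DualNumber Γ(X.left, U) := fun U =>
    (E U).symm.toRingHom.comp (q.appLE U (pr X ⁻¹ᵁ U) (hU U).ge).hom
  have hF : ∀ U a, dualToSections X U (F U a) = q.appLE U (pr X ⁻¹ᵁ U) (hU U).ge a :=
    fun U a => (E U).apply_symm_apply _
  have hfst : ∀ U a, (F U a).fst = a := fun U a => by
    rw [← zeroSecMap_dualToSections, hF, zeroSecMap_of_comp q h]
  have hc : ∀ U (c : ℂ), (F U (algebraMap ℂ _ c)).snd = 0 := fun U c => by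
    have : F U (algebraMap ℂ _ c) = TrivSqZeroExt.inl (algebraMap ℂ _ c) := by
      apply dualToSections_injective
      rw [hF, dualToSections_apply]
      simp only [TrivSqZeroExt.fst_inl, TrivSqZeroExt.snd_inl, map_zero, mul_zero, add_zero]
      rw [prMap_algebraMap]
      exact appLE_algebraMap (X := X ⊗ dual) (Y := X) (Over.homMk q hq) U _ _ c
    rw [this, TrivSqZeroExt.snd_inl]
  refine ⟨⟨fun U => derivationOfSection (F U) (hfst U) (hc U), fun U V hVU a => ?_⟩, fun U =>
    ⟨hU U, fun a => ?_⟩⟩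
  · change (F V (res X hVU a)).snd = res X hVU (F U a).snd
    have : F V (res X hVU a) = dualNumberMap (res X hVU) (F U a) := by
      apply dualToSections_injective
      rw [hF, dualToSections_res, hF]
      have e1 := ConcreteCategory.congr_hom (Scheme.Hom.map_appLE q (hU V).ge (homOfLE hVU).op) a
      have hp : pr X ⁻¹ᵁ V ≤ pr X ⁻¹ᵁ U := fun _ hx => hVU hx
      have e2 := ConcreteCategory.congr_hom (Scheme.Hom.appLE_map q (hU U).ge (homOfLE hp).op) a
      exact e1.trans e2.symm
    rw [this, snd_dualNumberMap]
  · rw [← hF, dualToSections_apply, hfst]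
    rfl

end OfRetraction

/-- The coefficient of `ε` is determined because `dualToSections` is injective. -/
theorem Deforms.unique {X : CSch} {q : (X ⊗ dual).left ⟶ X.left} {δ δ' : VectorField X}
    (h : Deforms q δ) (h' : Deforms q δ') : δ = δ' := by
  apply Subtype.ext
  funext U
  ext a
  obtain ⟨h1, h2⟩ := h U
  obtain ⟨h1', h2'⟩ := h' U
  have : dualToSections X U (expDerivation (δ.1 U) a) =
      dualToSections X U (expDerivation (δ'.1 U) a) := by
    simp only [dualToSections_apply, fst_expDerivation, snd_expDerivation]
    exact (h2 a).symm.trans (h2' a)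
  simpa using congrArg TrivSqZeroExt.snd (dualToSections_injective X U this)

theorem Deforms.congr {X : CSch} {q q' : (X ⊗ dual).left ⟶ X.left} {δ δ' : VectorField X}
    (h : Deforms q δ) (hq : q = q') (hδ : δ = δ') : Deforms q' δ' := by
  subst hq hδ
  exact h

theorem appLE_congr {Y Z : Scheme} {f g : Y ⟶ Z} (h : f = g) {U : Z.Opens} {V : Y.Opens}
    (hf : V ≤ f ⁻¹ᵁ U) (hg : V ≤ g ⁻¹ᵁ U) (a : Γ(Z, U)) : f.appLE U V hf a = g.appLE U V hg a := by
  subst h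
  rfl

theorem appLE_pr {X : CSch} (U : X.left.Opens) (h : pr X ⁻¹ᵁ U ≤ pr X ⁻¹ᵁ U) (a : Γ(X.left, U)) :
    (pr X).appLE U (pr X ⁻¹ᵁ U) h a = prMap X U a :=
  ConcreteCategory.congr_hom (Scheme.Hom.appLE_eq_app (pr X)) a

theorem pr_deforms (X : CSch) : Deforms (pr X) 0 := fun U => ⟨rfl, fun a => by
  refine (appLE_pr U _ a).trans ?_
  change _ = _ + _ * prMap X U 0
  simp⟩

/-- `(1 + εδ')(1 + εδ) = 1 + ε(δ + δ')`, the term in `ε²` being zero. -/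
theorem Deforms.comp {X : CSch} {u v : X ⊗ dual ⟶ X ⊗ dual} {δ δ' : VectorField X}
    (hu : Deforms (u ≫ fst X dual).left δ) (hv : Deforms (v ≫ fst X dual).left δ')
    (hv' : v ≫ snd X dual = snd X dual) :
    Deforms ((v ≫ u) ≫ fst X dual).left (δ + δ') := fun U => by
  have h : ((v ≫ u) ≫ fst X dual).left ⁻¹ᵁ U = pr X ⁻¹ᵁ U := by
    change (v.left ≫ (u ≫ fst X dual).left) ⁻¹ᵁ U = _
    rw [Scheme.Hom.comp_preimage, hu.preimage, ← Scheme.Hom.comp_preimage]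
    exact hv.preimage U
  refine ⟨h, fun a => ?_⟩
  obtain ⟨h1, h2⟩ := hv U
  refine (hu.comp_appLE v.left U (pr X ⁻¹ᵁ U) h1.ge h.ge a).trans ?_
  have e3 : (v.left ≫ prDual X).appLE ⊤ (pr X ⁻¹ᵁ U) (le_preimage_top _ _) epsilon =
      eps X _ := appLE_congr (congrArg CommaMorphism.left hv') _ _ _
  have e4 := eps_mul_eps X (pr X ⁻¹ᵁ U)
  rw [e3]
  erw [h2 a, h2 (δ.1 U a)]
  change _ = _ + _ * prMap X U (δ.1 U a + δ'.1 U a)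
  rw [map_add]
  linear_combination (prMap X U (δ'.1 U (δ.1 U a))) * e4

theorem Deforms.baseChange_scale {X : CSch} {u : X ⊗ dual ⟶ X ⊗ dual} {δ : VectorField X}
    (hu : Deforms (u ≫ fst X dual).left δ) (c : ℂ) :
    Deforms (baseChange X (dualScale c) u ≫ fst X dual).left (c • δ) := by
  have e : (baseChange X (dualScale c) u ≫ fst X dual).left =
      (X ◁ dualScale c).left ≫ (u ≫ fst X dual).left := by
    rw [baseChange, lift_fst]
    rfl
  have hp : (X ◁ dualScale c).left ≫ pr X = pr X :=
    congrArg CommaMorphism.left (whiskerLeft_fst X (dualScale c))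
  have hs : (X ◁ dualScale c).left ≫ prDual X = prDual X ≫ (dualScale c).left :=
    congrArg CommaMorphism.left (whiskerLeft_snd X (dualScale c))
  rw [e]
  intro U
  have h : ((X ◁ dualScale c).left ≫ (u ≫ fst X dual).left) ⁻¹ᵁ U = pr X ⁻¹ᵁ U := by
    rw [Scheme.Hom.comp_preimage, hu.preimage, ← Scheme.Hom.comp_preimage, hp]
  refine ⟨h, fun a => ?_⟩
  have h0 : pr X ⁻¹ᵁ U ≤ ((X ◁ dualScale c).left ≫ pr X) ⁻¹ᵁ U := by rw [hp]
  refine (hu.comp_appLE _ U (pr X ⁻¹ᵁ U) h0 h.ge a).trans ?_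
  have e3 : ((X ◁ dualScale c).left ≫ prDual X).appLE ⊤ (pr X ⁻¹ᵁ U) (le_preimage_top _ _) epsilon =
      algebraMap ℂ _ c * eps X _ := by
    refine (appLE_congr hs _ (le_preimage_top _ _) _).trans ?_
    refine (ConcreteCategory.congr_hom (Scheme.Hom.appLE_comp_appLE (prDual X) (dualScale c).left
      ⊤ ⊤ (pr X ⁻¹ᵁ U) (le_preimage_top _ _) (le_preimage_top _ _)) epsilon).symm.trans ?_
    refine (congrArg ((prDual X).appLE ⊤ (pr X ⁻¹ᵁ U) (le_preimage_top _ _)).hom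
      (dualScale_epsilon c)).trans ?_
    rw [map_mul]
    exact congrArg (· * _) (appLE_algebraMap (snd X dual) _ _ _ c)
  have e4 : ∀ b, ((X ◁ dualScale c).left ≫ pr X).appLE U (pr X ⁻¹ᵁ U) h0 b = prMap X U b :=
    fun b => (appLE_congr hp _ le_rfl _).trans (appLE_pr U _ b)
  rw [e3, e4, e4]
  change _ = _ + _ * prMap X U (c • δ.1 U a)
  rw [Algebra.smul_def, map_mul, prMap_algebraMap]
  ring

/-- The endomorphism `a ↦ a + ε δ(a)` of `X ⊗ Spec ℂ[ε]`. -/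
def deformEnd {X : CSch} (δ : VectorField X) : X ⊗ dual ⟶ X ⊗ dual :=
  lift (Over.homMk (deform δ) (deform_deforms δ).comp_hom) (snd X dual)

theorem deformEnd_snd {X : CSch} (δ : VectorField X) : deformEnd δ ≫ snd X dual = snd X dual :=
  lift_snd _ _

theorem deformEnd_deforms {X : CSch} (δ : VectorField X) :
    Deforms (deformEnd δ ≫ fst X dual).left δ :=
  (deform_deforms δ).congr
    (congrArg (fun f : X ⊗ dual ⟶ X => f.left) (lift_fst (Over.homMk (deform δ)
      (deform_deforms δ).comp_hom) (snd X dual))).symm rfl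

theorem endo_ext {X : CSch} {u v : X ⊗ dual ⟶ X ⊗ dual} {δ : VectorField X}
    (hu : Deforms (u ≫ fst X dual).left δ) (hv : Deforms (v ≫ fst X dual).left δ)
    (hu' : u ≫ snd X dual = snd X dual) (hv' : v ≫ snd X dual = snd X dual) : u = v :=
  CartesianMonoidalCategory.hom_ext _ _ (Over.OverMorphism.ext (hu.ext hv)) (hu'.trans hv'.symm)

/-- The composite deforms by `δ + δ' = 0`, as the identity does. -/
theorem deformEnd_comp {X : CSch} (δ δ' : VectorField X) (h : δ + δ' = 0) :
    deformEnd δ' ≫ deformEnd δ = 𝟙 _ :=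
  endo_ext ((deformEnd_deforms δ).comp (deformEnd_deforms δ') (deformEnd_snd δ'))
    ((pr_deforms X).congr (congrArg CommaMorphism.left (Category.id_comp _)).symm h.symm)
    (by rw [Category.assoc, deformEnd_snd, deformEnd_snd]) (Category.id_comp _)

/-- The automorphism `a ↦ a + ε δ(a)` of `X ⊗ Spec ℂ[ε]`. -/
def deformAut {X : CSch} (δ : VectorField X) : autOver X dual :=
  ⟨⟨deformEnd δ, deformEnd (-δ), deformEnd_comp _ _ (neg_add_cancel δ),
    deformEnd_comp _ _ (add_neg_cancel δ)⟩, deformEnd_snd δ⟩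

theorem deformAut_isOnePlusEps {X : CSch} (δ : VectorField X) : IsOnePlusEps (deformAut δ) δ :=
  deformEnd_deforms δ

theorem IsOnePlusEps.ext {X : CSch} {σ τ : autOver X dual} {δ : VectorField X}
    (hσ : IsOnePlusEps σ δ) (hτ : IsOnePlusEps τ δ) : σ = τ :=
  Subtype.ext (Iso.ext (endo_ext hσ hτ σ.2 τ.2))

theorem IsOnePlusEps.mul {X : CSch} {σ τ : autOver X dual} {δ δ' : VectorField X}
    (hσ : IsOnePlusEps σ δ) (hτ : IsOnePlusEps τ δ') : IsOnePlusEps (σ * τ) (δ + δ') :=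
  Deforms.comp (u := σ.1.hom) (v := τ.1.hom) hσ hτ τ.2

theorem IsOnePlusEps.autBaseChange_scale {X : CSch} {σ : autOver X dual} {δ : VectorField X}
    (hσ : IsOnePlusEps σ δ) (c : ℂ) :
    IsOnePlusEps (autBaseChange X (dualScale c) σ) (c • δ) :=
  Deforms.baseChange_scale (u := σ.1.hom) hσ c

/-- `a ↦ a + ε δ(a)` is the identity modulo `ε`. -/
theorem IsOnePlusEps.autBaseChange_dualZero {X : CSch} {σ : autOver X dual} {δ : VectorField X}
    (hσ : IsOnePlusEps σ δ) : autBaseChange X dualZero σ = 1 := by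
  have h0 : IsOnePlusEps (1 : autOver X dual) 0 :=
    (pr_deforms X).congr (congrArg CommaMorphism.left (Category.id_comp _)).symm rfl
  -- Setting `ε = 0` factors through `ε ↦ 0·ε`, which already turns `1 + εδ` into the identity.
  have h1 : autBaseChange X (dualScale 0) σ = 1 := by
    have := hσ.autBaseChange_scale 0
    rw [zero_smul] at this
    exact this.ext h0
  rw [← dualZero_scale 0, autBaseChange_comp, h1, map_one]

theorem exists_isOnePlusEps {X : CSch} {σ : autOver X dual}
    (hσ : autBaseChange X dualZero σ = 1) : ∃ δ, IsOnePlusEps σ δ :=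
  exists_deforms _ (congrArg CommaMorphism.left ((autBaseChange_dualZero_eq_one_iff σ).1 hσ))
    (Over.w _)

/-! ### Derivations that preserve the ideal of `Δ` -/

/-- The derivation `δ` maps the ideal sheaf of `Δ` to itself. -/
def PreservesIdeal {X Δ : CSch} (i : Δ ⟶ X) (δ : VectorField X) : Prop :=
  ∀ (U : X.left.Opens) (a : Γ(X.left, U)), i.left.app U a = 0 → i.left.app U (δ.1 U a) = 0

theorem app_eq_zero_of_appLE {Y Z : Scheme} (f : Y ⟶ Z) (U : Z.Opens) (a : Γ(Z, U))
    (h : f.appLE U (f ⁻¹ᵁ U) le_rfl a = 0) : f.app U a = 0 := by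
  rwa [Scheme.Hom.appLE_eq_app] at h

theorem appLE_comp_eq_zero {Y Z W : Scheme} (f : Y ⟶ Z) (g : Z ⟶ W) (U : W.Opens) (V : Y.Opens)
    (h : V ≤ (f ≫ g) ⁻¹ᵁ U) (a : Γ(W, U)) (ha : g.app U a = 0) : (f ≫ g).appLE U V h a = 0 := by
  have h' : V ≤ f ⁻¹ᵁ (g ⁻¹ᵁ U) := h
  refine (ConcreteCategory.congr_hom
    (Scheme.Hom.appLE_comp_appLE f g U (g ⁻¹ᵁ U) V le_rfl h') a).symm.trans ?_
  rw [Scheme.Hom.appLE_eq_app]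
  exact (congrArg (f.appLE (g ⁻¹ᵁ U) V h').hom ha).trans (map_zero _)

/-- The restriction to `Δ ⊗ Spec ℂ[ε]` of a morphism `a ↦ a + ε δ(a)`. -/
theorem Deforms.whiskerRight_appLE {X Δ : CSch} (i : Δ ⟶ X) {q : (X ⊗ dual).left ⟶ X.left}
    {δ : VectorField X} (hq : Deforms q δ) (U : X.left.Opens)
    (h : pr Δ ⁻¹ᵁ (i.left ⁻¹ᵁ U) ≤ ((i ▷ dual).left ≫ q) ⁻¹ᵁ U) (a : Γ(X.left, U)) :
    ((i ▷ dual).left ≫ q).appLE U (pr Δ ⁻¹ᵁ (i.left ⁻¹ᵁ U)) h a =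
      dualToSections Δ (i.left ⁻¹ᵁ U)
        (TrivSqZeroExt.inl (i.left.app U a) + TrivSqZeroExt.inr (i.left.app U (δ.1 U a))) := by
  have hp : (i ▷ dual).left ≫ pr X = pr Δ ≫ i.left :=
    congrArg CommaMorphism.left (whiskerRight_fst i dual)
  have hs : (i ▷ dual).left ≫ prDual X = prDual Δ :=
    congrArg CommaMorphism.left (whiskerRight_snd i dual)
  have h0 : pr Δ ⁻¹ᵁ (i.left ⁻¹ᵁ U) ≤ ((i ▷ dual).left ≫ pr X) ⁻¹ᵁ U := by
    rw [hp]
    exact le_rfl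
  have e3 : ((i ▷ dual).left ≫ prDual X).appLE ⊤ (pr Δ ⁻¹ᵁ (i.left ⁻¹ᵁ U)) (le_preimage_top _ _)
      epsilon = eps Δ _ := appLE_congr hs _ _ _
  have e4 : ∀ b, ((i ▷ dual).left ≫ pr X).appLE U (pr Δ ⁻¹ᵁ (i.left ⁻¹ᵁ U)) h0 b =
      prMap Δ _ (i.left.app U b) := fun b => by
    refine (appLE_congr hp _ le_rfl _).trans ?_
    exact ConcreteCategory.congr_hom ((Scheme.Hom.appLE_eq_app (pr Δ ≫ i.left)).trans
      (Scheme.Hom.comp_app (pr Δ) i.left U)) b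
  refine (hq.comp_appLE (i ▷ dual).left U _ h0 h a).trans ?_
  rw [e3, e4, e4, dualToSections_apply]
  simp

theorem Deforms.whiskerRight_preimage {X Δ : CSch} (i : Δ ⟶ X) {q : (X ⊗ dual).left ⟶ X.left}
    {δ : VectorField X} (hq : Deforms q δ) (U : X.left.Opens) :
    ((i ▷ dual).left ≫ q) ⁻¹ᵁ U = pr Δ ⁻¹ᵁ (i.left ⁻¹ᵁ U) := by
  have hp : (i ▷ dual).left ≫ pr X = pr Δ ≫ i.left :=
    congrArg CommaMorphism.left (whiskerRight_fst i dual)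
  rw [Scheme.Hom.comp_preimage, hq.preimage, ← Scheme.Hom.comp_preimage, hp,
    Scheme.Hom.comp_preimage]

/-- A function `a` in the ideal pulls back to `ε · (δa)|_Δ` on `Δ ⊗ dual`. The factorization through
`Δ ⊗ dual` makes this zero, and the coefficient of `ε` is well defined there. -/
theorem IsOnePlusEps.preservesIdeal {X Δ : CSch} (i : Δ ⟶ X) {σ : autOver X dual}
    {δ : VectorField X} (hσ : IsOnePlusEps σ δ) (h : σ ∈ (autPairFunctor i).obj (op dual)) :
    PreservesIdeal i δ := fun U a ha => by
  obtain ⟨τ, hτ⟩ := (mem_autPair i dual σ).1 h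
  have e : (i ▷ dual).left ≫ (σ.1.hom ≫ fst X dual).left = (τ ≫ fst Δ dual).left ≫ i.left := by
    have := congrArg (· ≫ fst X dual) hτ
    simp only [Category.assoc, whiskerRight_fst] at this
    have h2 := congrArg CommaMorphism.left this
    rw [← Category.assoc] at h2
    exact h2
  have hU := Deforms.whiskerRight_preimage i hσ U
  have h1 := Deforms.whiskerRight_appLE i hσ U hU.ge a
  have h2 : pr Δ ⁻¹ᵁ (i.left ⁻¹ᵁ U) ≤ ((τ ≫ fst Δ dual).left ≫ i.left) ⁻¹ᵁ U := by
    rw [← e]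
    exact hU.ge
  have h3 := (appLE_congr e hU.ge h2 a).symm.trans h1
  rw [appLE_comp_eq_zero _ _ _ _ _ _ ha] at h3
  have h4 := (map_eq_zero_iff _ (dualToSections_injective Δ _)).1 h3.symm
  simpa using congrArg TrivSqZeroExt.snd h4

/-- The map to `X` kills the ideal of `Δ`, so it lifts through the closed immersion. -/
theorem IsOnePlusEps.mem_autPair {X Δ : CSch} (i : Δ ⟶ X) [IsClosedImmersion i.left]
    {σ : autOver X dual} {δ : VectorField X} (hσ : IsOnePlusEps σ δ) (h : PreservesIdeal i δ) :
    σ ∈ (autPairFunctor i).obj (op dual) := by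
  have hker : i.left.ker ≤ ((i ▷ dual).left ≫ (σ.1.hom ≫ fst X dual).left).ker := by
    refine Scheme.IdealSheafData.le_ofIdeals_iff.2 fun U a ha => ?_
    have ha' : i.left.app U a = 0 := i.left.ideal_ker_le U ha
    have hU := Deforms.whiskerRight_preimage i hσ U
    have h1 := Deforms.whiskerRight_appLE i hσ U hU.ge a
    rw [ha', h U a ha'] at h1
    simp only [TrivSqZeroExt.inl_zero, TrivSqZeroExt.inr_zero, add_zero, map_zero] at h1
    refine app_eq_zero_of_appLE _ _ _ ?_
    have h2 := congrArg (res (Δ ⊗ dual) hU.le) h1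
    rw [map_zero] at h2
    refine (ConcreteCategory.congr_hom (Scheme.Hom.appLE_map _ hU.ge (homOfLE hU.le).op) a).symm.trans
      h2
  have hfac := IsClosedImmersion.lift_fac i.left
    ((i ▷ dual).left ≫ (σ.1.hom ≫ fst X dual).left) hker
  set g := IsClosedImmersion.lift i.left
    ((i ▷ dual).left ≫ (σ.1.hom ≫ fst X dual).left) hker
  have hg : g ≫ Δ.hom = (Δ ⊗ dual).hom := by
    rw [← Over.w i, reassoc_of% hfac]
    exact Over.w (i ▷ dual ≫ σ.1.hom ≫ fst X dual)
  refine (LogAut.mem_autPair i dual σ).2 ⟨lift (Over.homMk g hg) (snd Δ dual), ?_⟩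
  apply CartesianMonoidalCategory.hom_ext
  · rw [Category.assoc, Category.assoc, whiskerRight_fst, lift_fst_assoc]
    exact Over.OverMorphism.ext hfac.symm
  · rw [Category.assoc, Category.assoc, whiskerRight_snd, lift_snd]
    exact (congrArg _ σ.2).trans (whiskerRight_snd i dual)

/-! ### The Lie algebra of `A_{X,Δ}` and derivations that preserve the ideal of `Δ` -/

/-- The vector fields that preserve the ideal sheaf of `Δ`. -/
abbrev PreservingField {X Δ : CSch} (i : Δ ⟶ X) : Type :=
  {δ : VectorField X // PreservesIdeal i δ}

/-- The derivation `∂` for which `σ` is `a ↦ a + ε ∂(a)`. -/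
def lieToField {X Δ : CSch} (i : Δ ⟶ X) (σ : lie i) : PreservingField i :=
  ⟨(exists_isOnePlusEps σ.2.2).choose,
    (exists_isOnePlusEps σ.2.2).choose_spec.preservesIdeal i σ.2.1⟩

theorem lieToField_spec {X Δ : CSch} (i : Δ ⟶ X) (σ : lie i) :
    IsOnePlusEps σ.1 (lieToField i σ).1 :=
  (exists_isOnePlusEps σ.2.2).choose_spec

theorem IsOnePlusEps.unique {X : CSch} {σ : autOver X dual} {δ δ' : VectorField X}
    (h : IsOnePlusEps σ δ) (h' : IsOnePlusEps σ δ') : δ = δ' :=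
  Deforms.unique h h'

/-- The inverse is `deformAut`. -/
theorem lieToField_bijective {X Δ : CSch} (i : Δ ⟶ X) [IsClosedImmersion i.left] :
    Function.Bijective (lieToField i) := by
  refine ⟨fun σ τ h => Subtype.ext ?_, fun δ => ?_⟩
  · have h1 := lieToField_spec i σ
    rw [h] at h1
    exact h1.ext (lieToField_spec i τ)
  · have h := deformAut_isOnePlusEps δ.1
    refine ⟨⟨deformAut δ.1, h.mem_autPair i δ.2, h.autBaseChange_dualZero⟩, Subtype.ext ?_⟩
    exact (lieToField_spec i _).unique h

/-! ### Contraction of rational forms with a vector field -/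

open TensorProduct in
-- A localization is formally étale, so `Ω[K⁄ℂ]` is `K ⊗ Ω[A⁄ℂ]`, and the linear form on `Ω[A⁄ℂ]`
-- given by `d` extends to it.
theorem exists_linearMap_of_derivation {A K : Type*} [CommRing A] [Algebra ℂ A] [Field K]
    [Algebra ℂ K] [Algebra A K] [IsScalarTower ℂ A K] [IsFractionRing A K]
    (d : Derivation ℂ A A) :
    ∃ κ : Ω[K⁄ℂ] →ₗ[K] K, ∀ a : A,
      κ (KaehlerDifferential.D ℂ K (algebraMap A K a)) = algebraMap A K (d a) := by
  have : Algebra.FormallyEtale A K :=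
    Algebra.FormallyEtale.of_isLocalization (nonZeroDivisors A)
  let f : Ω[A⁄ℂ] →ₗ[A] K := (Algebra.linearMap A K).comp d.liftKaehlerDifferential
  let F : K ⊗[A] Ω[A⁄ℂ] →ₗ[K] K := f.liftBaseChange K
  refine ⟨F ∘ₗ (KaehlerDifferential.tensorKaehlerEquivOfFormallyEtale ℂ A K).symm.toLinearMap,
    fun a => ?_⟩
  rw [LinearMap.comp_apply, LinearEquiv.coe_coe,
    KaehlerDifferential.tensorKaehlerEquivOfFormallyEtale_symm_D_algebraMap]
  simp [F, f]

/-- A differential form over the fraction field becomes integral after multiplication by a nonzero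
element. -/
theorem exists_smul_mem_span_D {A K : Type*} [CommRing A] [IsDomain A] [Algebra ℂ A] [Field K]
    [Algebra ℂ K] [Algebra A K] [IsScalarTower ℂ A K] [IsFractionRing A K] (ω : Ω[K⁄ℂ]) :
    ∃ b : A, b ≠ 0 ∧ b • ω ∈ Submodule.span A
      (Set.range fun a : A => KaehlerDifferential.D ℂ K (algebraMap A K a)) := by
  set N := Submodule.span A
      (Set.range fun a : A => KaehlerDifferential.D ℂ K (algebraMap A K a))
  have hω : ω ∈ Submodule.span K (Set.range (KaehlerDifferential.D ℂ K)) := by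
    rw [KaehlerDifferential.span_range_derivation]
    trivial
  induction hω using Submodule.span_induction with
  | mem x hx =>
    obtain ⟨k, rfl⟩ := hx
    obtain ⟨a, b, hb, rfl⟩ := IsFractionRing.div_surjective (A := A) k
    have hb0 : b ≠ 0 := nonZeroDivisors.ne_zero hb
    have hbK : algebraMap A K b ≠ 0 := by simpa using hb0
    -- Quotient rule: `b² d(a/b) = b da - a db`.
    refine ⟨b * b, mul_ne_zero hb0 hb0, ?_⟩
    have h := (KaehlerDifferential.D ℂ K).leibniz (algebraMap A K b)
      (algebraMap A K a / algebraMap A K b)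
    rw [mul_div_cancel₀ _ hbK] at h
    have h2 : (b * b) • KaehlerDifferential.D ℂ K (algebraMap A K a / algebraMap A K b) =
        b • KaehlerDifferential.D ℂ K (algebraMap A K a) -
          a • KaehlerDifferential.D ℂ K (algebraMap A K b) := by
      rw [h, smul_add, ← algebraMap_smul K b, ← algebraMap_smul K b (_ • _), smul_smul, smul_smul,
        ← algebraMap_smul K a, ← algebraMap_smul K (b * b), map_mul,
        mul_div_cancel₀ _ hbK]
      simp
    rw [h2]
    exact sub_mem (N.smul_mem _ (Submodule.subset_span ⟨a, rfl⟩))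
      (N.smul_mem _ (Submodule.subset_span ⟨b, rfl⟩))
  | zero => exact ⟨1, one_ne_zero, by simp⟩
  | add x y _ _ hx hy =>
    obtain ⟨b, hb, hbx⟩ := hx
    obtain ⟨c, hc, hcy⟩ := hy
    refine ⟨b * c, mul_ne_zero hb hc, ?_⟩
    rw [smul_add]
    refine add_mem ?_ ?_
    · rw [mul_comm, mul_smul]
      exact N.smul_mem _ hbx
    · rw [mul_smul]
      exact N.smul_mem _ hcy
  | smul k x _ hx =>
    obtain ⟨b, hb, hbx⟩ := hx
    obtain ⟨a, c, hc, rfl⟩ := IsFractionRing.div_surjective (A := A) k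
    have hc0 : c ≠ 0 := nonZeroDivisors.ne_zero hc
    have hcK : algebraMap A K c ≠ 0 := by simpa using hc0
    refine ⟨c * b, mul_ne_zero hc0 hb, ?_⟩
    have : (c * b) • (algebraMap A K a / algebraMap A K c) • x = a • b • x := by
      rw [← algebraMap_smul K (c * b), ← algebraMap_smul K a, ← algebraMap_smul K b, smul_smul,
        smul_smul, map_mul]
      congr 1
      field_simp
    rw [this]
    exact N.smul_mem _ hbx

theorem exists_affine_le {Y : Scheme} (U : Y.Opens) [h : Nonempty U] :
    ∃ V : Y.Opens, IsAffineOpen V ∧ Nonempty V ∧ V ≤ U := by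
  obtain ⟨x⟩ := h
  obtain ⟨V, hV, hx, hVU⟩ := exists_affine_nhd Y U x
  exact ⟨V, hV, ⟨⟨_, hx⟩⟩, hVU⟩

/-! ### Contraction with a vector field on an integral scheme -/

section IntegralScheme

variable {X Δ : CSch} [IsIntegral X.left]

instance scalarTower_functionField (U : X.left.Opens) [Nonempty U] :
    IsScalarTower ℂ Γ(X.left, U) X.left.functionField :=
  .of_algebraMap_eq fun c => (scalar_functionField U c).symm

theorem algebraMap_functionField_injective (U : X.left.Opens) [Nonempty U] :
    Function.Injective (algebraMap Γ(X.left, U) X.left.functionField) :=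
  Scheme.germToFunctionField_injective X.left U

instance isDomain_sections (U : X.left.Opens) [Nonempty U] : IsDomain Γ(X.left, U) :=
  (algebraMap_functionField_injective U).isDomain

theorem algebraMap_res {U V : X.left.Opens} [Nonempty U] [Nonempty V] (h : V ≤ U)
    (a : Γ(X.left, U)) :
    algebraMap _ X.left.functionField (res X h a) = algebraMap _ X.left.functionField a := by
  obtain ⟨x⟩ := ‹Nonempty V›
  rw [germ_functionField V x.1 x.2, germ_functionField U x.1 (h x.2)]
  congr 1
  exact TopCat.Presheaf.germ_res_apply X.left.presheaf (homOfLE h) x.1 x.2 a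

theorem nonempty_inf (U V : X.left.Opens) [Nonempty U] [Nonempty V] : Nonempty (U ⊓ V : X.left.Opens) := by
  obtain ⟨x, hx⟩ := nonempty_preirreducible_inter U.isOpen V.isOpen
    (Set.nonempty_coe_sort.1 ‹Nonempty U›) (Set.nonempty_coe_sort.1 ‹Nonempty V›)
  exact ⟨⟨x, hx⟩⟩

/-- One affine open `V` determines the contraction on rational forms; its compatibility with `δ` on
any other `U` follows because `U` meets `V`. -/
theorem exists_contraction (δ : VectorField X) :
    ∃ κ : RatForm X →ₗ[X.left.functionField] X.left.functionField,
      ∀ (U : X.left.Opens) [Nonempty U] (a : Γ(X.left, U)),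
        κ (KaehlerDifferential.D ℂ X.left.functionField (algebraMap _ _ a)) =
          algebraMap _ X.left.functionField (δ.1 U a) := by
  have : Nonempty (⊤ : X.left.Opens) := ⟨⟨genericPoint X.left, trivial⟩⟩
  obtain ⟨V, hV, hne, -⟩ := exists_affine_le (Y := X.left) ⊤
  have := functionField_isFractionRing_of_isAffineOpen X.left V hV
  obtain ⟨κ, hκ⟩ := exists_linearMap_of_derivation (K := X.left.functionField) (δ.1 V)
  refine ⟨κ, fun U _ a => ?_⟩
  have := nonempty_inf U V
  -- Write `a = c/d` with `c`, `d` regular on `V`. Leibniz's rule for `d·a = c`, once for `δ` on `U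
  -- ⊓ V` and once for `κ ∘ D`, gives the same equation for both values at `a`.
  obtain ⟨c, d, hd, hcd⟩ := IsFractionRing.div_surjective (A := Γ(X.left, V))
    (algebraMap _ X.left.functionField a)
  have hd0 : algebraMap _ X.left.functionField d ≠ 0 := by
    simpa using nonZeroDivisors.ne_zero hd
  have h1 : algebraMap _ X.left.functionField d * algebraMap _ X.left.functionField a =
      algebraMap _ X.left.functionField c := by
    rw [← hcd, mul_div_cancel₀ _ hd0]
  have h2 : res X (inf_le_right : U ⊓ V ≤ V) d * res X (inf_le_left : U ⊓ V ≤ U) a =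
      res X (inf_le_right : U ⊓ V ≤ V) c := by
    apply algebraMap_functionField_injective (U ⊓ V)
    rw [map_mul, algebraMap_res, algebraMap_res, algebraMap_res, h1]
  have h3 := congrArg (algebraMap _ X.left.functionField) (congrArg (δ.1 (U ⊓ V)) h2)
  rw [Derivation.leibniz, δ.2, δ.2, δ.2, smul_eq_mul, smul_eq_mul, map_add, map_mul, map_mul,
    algebraMap_res, algebraMap_res, algebraMap_res, algebraMap_res, algebraMap_res] at h3
  have h4 := congrArg (fun x => κ (KaehlerDifferential.D ℂ X.left.functionField x)) h1
  simp only [Derivation.leibniz, map_add, map_smul, hκ, smul_eq_mul] at h4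
  have h5 := h4.trans h3.symm
  exact mul_left_cancel₀ hd0 (add_right_cancel h5)

/-- Contraction of rational forms with the vector field `δ`. -/
def contraction (δ : VectorField X) : RatForm X →ₗ[X.left.functionField] X.left.functionField :=
  (exists_contraction δ).choose

theorem contraction_D (δ : VectorField X) (U : X.left.Opens) [Nonempty U] (a : Γ(X.left, U)) :
    contraction δ (KaehlerDifferential.D ℂ X.left.functionField (algebraMap _ _ a)) =
      algebraMap _ X.left.functionField (δ.1 U a) :=
  (exists_contraction δ).choose_spec U a

theorem contraction_smul (δ : VectorField X) (U : X.left.Opens) [Nonempty U] (a : Γ(X.left, U))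
    (ω : RatForm X) :
    contraction δ (a • ω) = algebraMap _ X.left.functionField a * contraction δ ω := by
  rw [← algebraMap_smul X.left.functionField a ω, map_smul, smul_eq_mul]

theorem toVectorField_apply (i : Δ ⟶ X) (φ : LogVectorField i) (U : X.left.Opens) [h : Nonempty U]
    (a : Γ(X.left, U)) : ((toVectorField i φ).1 U) a = φ.1 ⟨U, h⟩ (dForm i U a) := by
  simp only [toVectorField, LinearMap.coe_mk, AddHom.coe_mk, dif_pos h]
  rfl

/-- A logarithmic vector field acts on forms by contraction with the underlying vector field. -/
theorem algebraMap_logVectorField_apply (i : Δ ⟶ X) (φ : LogVectorField i) (U : NEOpens X)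
    (ω : logForm i U.1) :
    algebraMap _ X.left.functionField (φ.1 U ω) = contraction (toVectorField i φ) ω.1 := by
  obtain ⟨V, hV, hne, hVU⟩ := exists_affine_le (Y := X.left) U.1
  have := functionField_isFractionRing_of_isAffineOpen X.left V hV
  rw [← algebraMap_res hVU, ← φ.2 U ⟨V, hne⟩ hVU ω]
  have hω := logForm_mono i hVU ω.2
  -- On the span of exact forms linearity forces `φ` to be the contraction. Some nonzero multiple `b
  -- • ω` lies in that span, and `b` can be cancelled in the function field.
  obtain ⟨b, hb, hbω⟩ := exists_smul_mem_span_D (A := Γ(X.left, V)) ω.1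
  have hS : Submodule.span Γ(X.left, V) (Set.range fun a : Γ(X.left, V) =>
      KaehlerDifferential.D ℂ X.left.functionField (algebraMap _ X.left.functionField a)) ≤
      logForm i V := by
    rw [Submodule.span_le]
    rintro _ ⟨a, rfl⟩
    exact (dForm i V a).2
  have key : ∀ x hx, algebraMap _ X.left.functionField (φ.1 ⟨V, hne⟩ ⟨x, hS hx⟩) =
      contraction (toVectorField i φ) x := fun x hx => by
    induction hx using Submodule.span_induction with
    | mem x hx =>
      obtain ⟨a, rfl⟩ := hx
      rw [contraction_D, toVectorField_apply]
      rfl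
    | zero =>
      rw [map_zero]
      exact (congrArg _ (map_zero (φ.1 ⟨V, hne⟩))).trans (map_zero _)
    | add x y hx hy h1 h2 =>
      rw [map_add, ← h1, ← h2, ← map_add, ← map_add]
      rfl
    | smul a x hx h1 =>
      rw [contraction_smul, ← h1, ← map_mul, ← smul_eq_mul, ← map_smul]
      rfl
  have h1 := key _ hbω
  rw [contraction_smul] at h1
  refine mul_left_cancel₀ ((map_ne_zero_iff _ (algebraMap_functionField_injective V)).2 hb)
    (Eq.trans ?_ h1)
  rw [← map_mul, ← smul_eq_mul, ← map_smul]
  rfl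

/-- The values of `φ` are contractions, which depend only on the underlying derivation. -/
theorem toVectorField_injective (i : Δ ⟶ X) : Function.Injective (toVectorField i) := by
  intro φ ψ h
  apply Subtype.ext
  funext U
  ext ω
  apply algebraMap_functionField_injective U.1
  rw [algebraMap_logVectorField_apply, algebraMap_logVectorField_apply, h]

end IntegralScheme

/-! ### Extension of functions over closed subsets of codimension two -/

/-- An element of the fraction field of a normal noetherian domain is integral if it is so at all
primes of height at most one. -/
theorem mem_range_of_height_le_one {A K : Type*} [CommRing A] [IsDomain A] [IsNoetherianRing A]
    [IsIntegrallyClosed A] [Field K] [Algebra A K] [IsFractionRing A K] (f : K)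
    (h : ∀ p : Ideal A, p.IsPrime → p.height ≤ 1 →
      ∃ a b : A, b ∉ p ∧ algebraMap A K b * f = algebraMap A K a) :
    f ∈ (algebraMap A K).range := by
  by_contra hf
  let N : Submodule A K := LinearMap.range (Algebra.linearMap A K)
  have hN : ∀ x : K, x ∈ N ↔ x ∈ (algebraMap A K).range := fun x => Iff.rfl
  have hmk : (N.mkQ f : K ⧸ N) ≠ 0 := by
    rw [Submodule.mkQ_apply, Ne, Submodule.Quotient.mk_eq_zero, hN]
    exact hf
  -- The annihilator of the class of `f` in `K/A` lies in an associated prime `P`, itself the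
  -- annihilator of a class `g`. A contradiction follows once `P` has height at most one.
  obtain ⟨P, hass, hle⟩ := exists_le_isAssociatedPrime_of_isNoetherianRing A _ hmk
  obtain ⟨hP, x, hx⟩ := isAssociatedPrime_iff.1 hass
  obtain ⟨g, rfl⟩ := N.mkQ_surjective x
  have hPg : ∀ b : A, b ∈ P ↔ algebraMap A K b * g ∈ (algebraMap A K).range := fun b => by
    rw [hx, Submodule.mem_colon_singleton, ← map_smul, Submodule.mem_bot, Submodule.mkQ_apply,
      Submodule.Quotient.mk_eq_zero, hN, Algebra.smul_def]
  have hPf : ∀ b : A, algebraMap A K b * f ∈ (algebraMap A K).range → b ∈ P := fun b hb => by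
    apply hle
    rwa [Submodule.mem_colon_singleton, ← map_smul, Submodule.mem_bot, Submodule.mkQ_apply,
      Submodule.Quotient.mk_eq_zero, hN, Algebra.smul_def]
  have hgN : g ∉ (algebraMap A K).range := fun hg => hP.ne_top <| (Ideal.eq_top_iff_one _).2 <|
    (hPg 1).2 (by simpa using hg)
  have hht : P.height ≤ 1 := by
    -- Here `P g ⊆ A`. If some `x ∈ P` has `x g ∉ P`, then `P` is minimal over `(x)` and Krull's
    -- principal ideal theorem applies. Otherwise `P g ⊆ P`; unless `P = 0`, the determinant trick
    -- makes `g` integral over `A`, hence an element of `A`, which is absurd.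
    by_cases hJ : ∃ x ∈ P, ∃ u : A, u ∉ P ∧ algebraMap A K x * g = algebraMap A K u
    · obtain ⟨x, hxP, u, hu, hxu⟩ := hJ
      refine Ideal.height_le_one_of_isPrincipal_of_mem_minimalPrimes (Ideal.span {x}) P
        ⟨⟨hP, (Ideal.span_singleton_le_iff_mem _).2 hxP⟩, ?_⟩
      rintro Q ⟨hQ, hxQ⟩ hQP y hy
      obtain ⟨z, hz⟩ := (hPg y).1 hy
      have e : y * u = x * z := by
        apply IsFractionRing.injective A K
        rw [map_mul, map_mul, ← hxu, hz]
        ring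
      refine (hQ.mem_or_mem (x := y) (y := u) ?_).resolve_right fun hu' => hu (hQP hu')
      rw [e]
      exact Q.mul_mem_right _ ((Ideal.span_singleton_le_iff_mem _).1 hxQ)
    · by_cases hP0 : P = ⊥
      · subst hP0
        simp
      refine (hgN ?_).elim
      push Not at hJ
      let M : Submodule A K := Submodule.map (Algebra.linearMap A K) P
      have hM : IsIntegral A g := by
        refine isIntegral_of_smul_mem_submodule (R := A) (A := K) (M := K) M ?_
          ((IsNoetherian.noetherian P).map _) g ?_
        · intro h0
          apply hP0
          rw [eq_bot_iff]
          intro b hb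
          have : algebraMap A K b ∈ M := ⟨b, hb, rfl⟩
          rw [h0] at this
          exact (map_eq_zero_iff _ (IsFractionRing.injective A K)).1 this
        · rintro _ ⟨b, hb, rfl⟩
          obtain ⟨u, hu⟩ := (hPg b).1 hb
          refine ⟨u, ?_, ?_⟩
          · by_contra hu'
            exact hJ b hb u hu' hu.symm
          · rw [smul_eq_mul, mul_comm]
            exact hu
      obtain ⟨a, ha⟩ := IsIntegrallyClosed.isIntegral_iff.1 hM
      exact ⟨a, ha⟩
  -- A denominator of `f` outside `P` would annihilate the class of `f`, yet that annihilator is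
  -- contained in `P`.
  obtain ⟨a, b, hb, hab⟩ := h P hP hht
  exact hb (hPf b ⟨a, hab.symm⟩)

/-! ### Regularity of rational functions on a normal scheme -/

section IntegralScheme

variable {X : CSch} [IsIntegral X.left]

theorem exists_primeIdealOf_eq {Y : Scheme} {V : Y.Opens} (hV : IsAffineOpen V)
    (p : Spec Γ(Y, V)) : ∃ x : V, hV.primeIdealOf x = p := by
  refine ⟨hV.isoSpec.inv p, ?_⟩
  change hV.isoSpec.hom (hV.isoSpec.inv p) = p
  rw [← Scheme.Hom.comp_apply, Iso.inv_hom_id]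
  rfl

/-- Being integrally closed can be tested at maximal ideals, where the localizations are stalks. -/
theorem isIntegrallyClosed_sections (hX : ∀ x : X.left, IsIntegrallyClosed (X.left.presheaf.stalk x))
    (V : X.left.Opens) [Nonempty V] (hV : IsAffineOpen V) : IsIntegrallyClosed Γ(X.left, V) := by
  refine IsIntegrallyClosed.of_localization_maximal fun p _ hp => ?_
  obtain ⟨x, hx⟩ := exists_primeIdealOf_eq hV ⟨p, hp.isPrime⟩
  have h1 := hV.isLocalization_stalk x
  obtain rfl : (hV.primeIdealOf x).asIdeal = p := congrArg PrimeSpectrum.asIdeal hx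
  have := hX x
  exact IsIntegrallyClosed.of_equiv (IsLocalization.algEquiv
    (hV.primeIdealOf x).asIdeal.primeCompl (X.left.presheaf.stalk x.1)
    (Localization.AtPrime (hV.primeIdealOf x).asIdeal)).toRingEquiv

/-- Primes of `Γ(V)` are points of `V`, and the height of a prime is the coheight of the point, both
being the dimension of the stalk. -/
theorem mem_range_algebraMap_of_isAffineOpen [IsLocallyNoetherian X.left]
    (hX : ∀ x : X.left, IsIntegrallyClosed (X.left.presheaf.stalk x))
    (V : X.left.Opens) [Nonempty V] (hV : IsAffineOpen V) (f : X.left.functionField)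
    (hf : ∀ x ∈ V, Order.coheight x ≤ 1 →
      f ∈ (algebraMap (X.left.presheaf.stalk x) X.left.functionField).range) :
    f ∈ (algebraMap Γ(X.left, V) X.left.functionField).range := by
  have := isIntegrallyClosed_sections hX V hV
  have := functionField_isFractionRing_of_isAffineOpen X.left V hV
  have : IsNoetherianRing Γ(X.left, V) := IsLocallyNoetherian.component_noetherian ⟨V, hV⟩
  refine mem_range_of_height_le_one f fun p hp hht => ?_
  obtain ⟨x, hx⟩ := exists_primeIdealOf_eq hV ⟨p, hp⟩
  have h1 := hV.isLocalization_stalk x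
  obtain rfl : (hV.primeIdealOf x).asIdeal = p := congrArg PrimeSpectrum.asIdeal hx
  have hco : Order.coheight x.1 ≤ 1 := by
    have := (ringKrullDim_stalk_eq_coheight x.1).symm.trans
      (IsLocalization.AtPrime.ringKrullDim_eq_height (hV.primeIdealOf x).asIdeal
        (X.left.presheaf.stalk x.1))
    rw [WithBot.coe_inj.1 this]
    exact hht
  obtain ⟨s, hs⟩ := hf x.1 x.2 hco
  obtain ⟨⟨a, b⟩, hab⟩ := IsLocalization.surj (hV.primeIdealOf x).asIdeal.primeCompl s
  refine ⟨a, b.1, b.2, ?_⟩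
  rw [germ_functionField V x.1 x.2, germ_functionField V x.1 x.2, ← hs, ← map_mul, mul_comm]
  exact congrArg _ hab

/-- A rational function on a normal scheme is regular on `U` if it is so at the points of `U` of
codimension at most one. -/
theorem mem_range_algebraMap_of_coheight_le_one [IsLocallyNoetherian X.left]
    (hX : ∀ x : X.left, IsIntegrallyClosed (X.left.presheaf.stalk x))
    (U : X.left.Opens) [Nonempty U] (f : X.left.functionField)
    (hf : ∀ x ∈ U, Order.coheight x ≤ 1 →
      f ∈ (algebraMap (X.left.presheaf.stalk x) X.left.functionField).range) :
    f ∈ (algebraMap Γ(X.left, U) X.left.functionField).range := by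
  choose V hV hxV hVU using exists_affine_nhd X.left U
  have hne : ∀ i, Nonempty (V i) := fun i => ⟨⟨_, hxV i⟩⟩
  choose s hs using fun i => mem_range_algebraMap_of_isAffineOpen hX (V i) (hV i) f
    fun x hx => hf x (hVU i hx)
  obtain ⟨t, ht⟩ := exists_glue X U V hVU (le_iSup_of_mem U V hxV) s fun i j => by
    have := hne i
    have := hne j
    have := nonempty_inf (V i) (V j)
    apply algebraMap_functionField_injective (V i ⊓ V j)
    rw [algebraMap_res, algebraMap_res, hs, hs]
  obtain ⟨i⟩ : Nonempty U := ‹_›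
  have := hne i
  exact ⟨t, (algebraMap_res (hVU i) t).symm.trans ((congrArg _ (ht i)).trans (hs i))⟩

end IntegralScheme

/-! ### The ideal sheaf of `Δ` at points of codimension at most one -/

theorem germ_app {Y Z : Scheme} (f : Y ⟶ Z) (U : Z.Opens) (y : Y) (hy : f y ∈ U) (a : Γ(Z, U)) :
    f.stalkMap y (Z.presheaf.germ U (f y) hy a) = Y.presheaf.germ (f ⁻¹ᵁ U) y hy (f.app U a) :=
  Scheme.Hom.germ_stalkMap_apply f U y hy a

section Ideal

variable {X Δ : CSch} (i : Δ ⟶ X)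

theorem app_res_eq_zero {U V : X.left.Opens} (h : V ≤ U) {a : Γ(X.left, U)}
    (ha : i.left.app U a = 0) : i.left.app V (res X h a) = 0 := by
  have H := ConcreteCategory.congr_hom (i.left.naturality (homOfLE h).op) a
  refine H.trans ?_
  exact (congrArg (Δ.left.presheaf.map _).hom ha).trans (map_zero _)

/-- Germs of functions vanishing on `Δ` already form an ideal, since finitely many of them live on a
common neighbourhood. -/
theorem mem_idealStalk_iff (x : X.left) (t : X.left.presheaf.stalk x) :
    t ∈ idealStalk i x ↔ ∃ (U : X.left.Opens) (hx : x ∈ U) (a : Γ(X.left, U)),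
      i.left.app U a = 0 ∧ X.left.presheaf.germ U x hx a = t := by
  let J : Ideal (X.left.presheaf.stalk x) :=
    { carrier := {t | ∃ (U : X.left.Opens) (hx : x ∈ U) (a : Γ(X.left, U)),
        i.left.app U a = 0 ∧ X.left.presheaf.germ U x hx a = t}
      zero_mem' := ⟨⊤, trivial, 0, map_zero _, map_zero _⟩
      add_mem' := by
        rintro _ _ ⟨U, hx, a, ha, rfl⟩ ⟨V, hx', b, hb, rfl⟩
        refine ⟨U ⊓ V, ⟨hx, hx'⟩, res X inf_le_left a + res X inf_le_right b, ?_, ?_⟩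
        · rw [map_add, app_res_eq_zero i _ ha, app_res_eq_zero i _ hb, add_zero]
        · rw [map_add]
          exact congrArg₂ _ (TopCat.Presheaf.germ_res_apply X.left.presheaf (homOfLE _) x _ a)
            (TopCat.Presheaf.germ_res_apply X.left.presheaf (homOfLE _) x _ b)
      smul_mem' := by
        rintro c _ ⟨V, hx', b, hb, rfl⟩
        obtain ⟨U, hx, a, rfl⟩ := X.left.presheaf.exists_germ_eq c
        refine ⟨U ⊓ V, ⟨hx, hx'⟩, res X inf_le_left a * res X inf_le_right b, ?_, ?_⟩
        · rw [map_mul, app_res_eq_zero i _ hb, mul_zero]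
        · rw [map_mul]
          exact congrArg₂ _ (TopCat.Presheaf.germ_res_apply X.left.presheaf (homOfLE _) x _ a)
            (TopCat.Presheaf.germ_res_apply X.left.presheaf (homOfLE _) x _ b) }
  constructor
  · intro ht
    have : idealStalk i x ≤ J := by
      refine iSup₂_le fun U hx => Ideal.map_le_iff_le_comap.2 fun a ha => ?_
      exact ⟨U, hx, a, ha, rfl⟩
    exact this ht
  · rintro ⟨U, hx, a, ha, rfl⟩
    exact (le_iSup₂_of_le U hx le_rfl : _ ≤ idealStalk i x) (Ideal.mem_map_of_mem _ ha)

theorem germ_mem_idealStalk {U : X.left.Opens} {x : X.left} (hx : x ∈ U) {a : Γ(X.left, U)}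
    (ha : i.left.app U a = 0) : X.left.presheaf.germ U x hx a ∈ idealStalk i x :=
  (mem_idealStalk_iff i x _).2 ⟨U, hx, a, ha, rfl⟩

variable [IsClosedImmersion i.left]

/-- A germ that dies on `Δ` dies on a neighbourhood in `Δ`, which is the trace of an open subset of
`X` because `Δ` has the induced topology. -/
theorem idealStalk_eq_ker (y : Δ.left) :
    idealStalk i (i.left y) = RingHom.ker (i.left.stalkMap y).hom := by
  ext t
  rw [mem_idealStalk_iff, RingHom.mem_ker]
  constructor
  · rintro ⟨U, hx, a, ha, rfl⟩
    refine (germ_app i.left U y hx a).trans ?_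
    rw [ha, map_zero]
  · intro ht
    obtain ⟨U, hx, a, rfl⟩ := X.left.presheaf.exists_germ_eq t
    have h1 : Δ.left.presheaf.germ (i.left ⁻¹ᵁ U) y hx (i.left.app U a) =
        Δ.left.presheaf.germ (i.left ⁻¹ᵁ U) y hx 0 :=
      (germ_app i.left U y hx a).symm.trans (ht.trans (map_zero _).symm)
    obtain ⟨W, hW, k, k', hk⟩ := Δ.left.presheaf.germ_eq y hx hx _ _ h1
    obtain ⟨V, hV, hVW⟩ := i.left.isClosedEmbedding.isInducing.isOpen_iff.1 W.isOpen
    let V' : X.left.Opens := ⟨V, hV⟩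
    have hyV : i.left y ∈ V' := by
      have : y ∈ i.left ⁻¹' V := by rw [hVW]; exact hW
      exact this
    refine ⟨V' ⊓ U, ⟨hyV, hx⟩, res X inf_le_right a, ?_,
      TopCat.Presheaf.germ_res_apply X.left.presheaf (homOfLE _) _ _ a⟩
    have H := ConcreteCategory.congr_hom (i.left.naturality
      (homOfLE (inf_le_right : V' ⊓ U ≤ U)).op) a
    refine H.trans ?_
    have hle : i.left ⁻¹ᵁ (V' ⊓ U) ≤ W := fun z hz => by
      have : z ∈ i.left ⁻¹' V := hz.1
      rwa [hVW] at this
    have h2 := congrArg (res Δ hle) hk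
    rw [map_zero, map_zero] at h2
    refine Eq.trans ?_ h2
    exact (ConcreteCategory.congr_hom (Δ.left.presheaf.map_comp k.op (homOfLE hle).op)
      (i.left.app U a))

/-- On the complement of `Δ` the function `1` restricts to the zero ring. -/
theorem idealStalk_eq_top {x : X.left} (hx : x ∉ Set.range i.left) : idealStalk i x = ⊤ := by
  let U : X.left.Opens := ⟨(Set.range i.left)ᶜ, i.left.isClosedEmbedding.isClosed_range.isOpen_compl⟩
  have hU : i.left ⁻¹ᵁ U = ⊥ := by
    ext z
    exact ⟨fun hz => (hz ⟨z, rfl⟩).elim, fun hz => hz.elim⟩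
  rw [Ideal.eq_top_iff_one, mem_idealStalk_iff]
  refine ⟨U, hx, 1, ?_, map_one _⟩
  have : Subsingleton Γ(Δ.left, i.left ⁻¹ᵁ U) := by
    rw [hU]
    infer_instance
  exact Subsingleton.elim _ _

/-- A reduced scheme has a field as local ring at a generic point, so the kernel of the surjection
onto it is maximal. -/
theorem idealStalk_genericPoints [IsReduced Δ.left] {ξ : Δ.left} (hξ : ξ ∈ genericPoints Δ.left) :
    idealStalk i (i.left ξ) = IsLocalRing.maximalIdeal (X.left.presheaf.stalk (i.left ξ)) := by
  rw [idealStalk_eq_ker]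
  have hF := isField_stalk_of_closure_mem_irreducibleComponents Δ.left ξ hξ
  let _ := hF.toField
  exact IsLocalRing.eq_maximalIdeal
    (RingHom.ker_isMaximal_of_surjective (i.left.stalkMap ξ).hom (i.left.stalkMap_surjective ξ))

end Ideal

/-- The point is a specialization of the generic point of a component, which has coheight one; were
it different, its coheight would exceed one. -/
theorem IsReducedDivisor.exists_genericPoint {X Δ : CSch} {i : Δ ⟶ X} (h : IsReducedDivisor i)
    {x : X.left} (hx : Order.coheight x ≤ 1) (hx' : x ∈ Set.range i.left) :
    ∃ ξ ∈ genericPoints Δ.left, i.left ξ = x := by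
  obtain ⟨y, rfl⟩ := hx'
  let ξ := genericPoints.ofComponent ⟨_, irreducibleComponent_mem_irreducibleComponents y⟩
  have hs : ξ.1 ⤳ y := by
    rw [specializes_iff_mem_closure]
    have := genericPoints.isGenericPoint_ofComponent
      ⟨_, irreducibleComponent_mem_irreducibleComponents y⟩
    rw [this.def]
    exact mem_irreducibleComponent
  refine ⟨ξ.1, ξ.2, ?_⟩
  by_contra hne
  have hs' : i.left ξ.1 ⤳ i.left y := hs.map i.left.continuous
  have hlt : i.left y < i.left ξ.1 := by
    refine lt_of_le_not_ge hs' fun hs'' => hne ?_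
    exact ((hs'.antisymm hs'').eq)
  have h1 := h.codim_one ξ.1 ξ.2
  have h2 := Order.coheight_strictAnti hlt (by rw [h1]; exact ENat.natCast_lt_top 1)
  rw [h1] at h2
  exact absurd h2 (not_lt.2 hx)

section CodimOne

variable {X Δ : CSch} [IsIntegral X.left] [IsLocallyNoetherian X.left] {i : Δ ⟶ X}

/-- A normal noetherian local domain of dimension at most one is a local Dedekind domain, hence
principal. -/
theorem isPrincipalIdealRing_stalk (hX : ∀ x : X.left, IsIntegrallyClosed (X.left.presheaf.stalk x))
    {x : X.left} (hx : Order.coheight x ≤ 1) : IsPrincipalIdealRing (X.left.presheaf.stalk x) := by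
  have := hX x
  have h1 : Ring.KrullDimLE 1 (X.left.presheaf.stalk x) := krullDimLE_of_coheight_le hx
  have h2 : Ring.DimensionLEOne (X.left.presheaf.stalk x) :=
    ⟨fun {p} hp hp' => hp'.isMaximal_of_ne_bot hp⟩
  have h3 : IsDedekindRing (X.left.presheaf.stalk x) := { }
  have h4 : IsDedekindDomain (X.left.presheaf.stalk x) := { }
  infer_instance

/-- The local ring is a field or a discrete valuation ring. The ideal of `Δ` there is the unit ideal
(empty product of parameters) or, at a generic point of `Δ`, the maximal ideal (the uniformizer). -/
theorem isLogSmoothAt_of_coheight_le_one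
    (hX : ∀ x : X.left, IsIntegrallyClosed (X.left.presheaf.stalk x)) (h : IsReducedDivisor i)
    {x : X.left} (hx : Order.coheight x ≤ 1) : IsLogSmoothAt i x := by
  have := isPrincipalIdealRing_stalk hX hx
  have := h.isClosedImmersion
  have := h.isReduced
  refine ⟨inferInstance, ?_⟩
  have hd : idealStalk i x = ⊤ ∨
      idealStalk i x = IsLocalRing.maximalIdeal (X.left.presheaf.stalk x) ∧
        Order.coheight x = 1 := by
    by_cases hx' : x ∈ Set.range i.left
    · obtain ⟨ξ, hξ, rfl⟩ := h.exists_genericPoint hx hx'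
      exact Or.inr ⟨idealStalk_genericPoints i hξ, h.codim_one ξ hξ⟩
    · exact Or.inl (idealStalk_eq_top i hx')
  have hdim := ringKrullDim_stalk_eq_coheight x
  obtain ⟨ϖ, hϖ⟩ := (IsPrincipalIdealRing.principal
    (IsLocalRing.maximalIdeal (X.left.presheaf.stalk x))).principal
  by_cases h0 : Order.coheight x = 0
  · refine ⟨0, ![], ∅, ?_, ?_, ?_⟩
    · rw [hdim, h0]
      rfl
    · rw [h0] at hdim
      have hF : IsField (X.left.presheaf.stalk x) := by
        have : Ring.KrullDimLE 0 (X.left.presheaf.stalk x) :=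
          krullDimLE_of_coheight_le h0.le
        exact Ring.KrullDimLE.isField_of_isDomain
      rw [IsLocalRing.isField_iff_maximalIdeal_eq.1 hF]
      simp
    · rw [Finset.prod_empty, Ideal.span_singleton_one]
      refine hd.resolve_right fun h' => ?_
      rw [h0] at h'
      exact zero_ne_one h'.2
  · have h1 : Order.coheight x = 1 := le_antisymm hx (Order.one_le_iff_ne_zero.2 h0)
    obtain hd | hd := hd
    · refine ⟨1, ![ϖ], ∅, ?_, ?_, ?_⟩
      · rw [hdim, h1]
        rfl
      · simpa using hϖ.symm
      · simpa using hd
    · refine ⟨1, ![ϖ], Finset.univ, ?_, ?_, ?_⟩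
      · rw [hdim, h1]
        rfl
      · simpa using hϖ.symm
      · simpa using hd.1.trans hϖ

end CodimOne

/-! ### Vector fields that preserve the ideal of `Δ` are logarithmic -/

theorem germ_res {X : CSch} {U V : X.left.Opens} (h : V ≤ U) {x : X.left} (hx : x ∈ V)
    (a : Γ(X.left, U)) :
    X.left.presheaf.germ V x hx (res X h a) = X.left.presheaf.germ U x (h hx) a :=
  TopCat.Presheaf.germ_res_apply X.left.presheaf (homOfLE h) x hx a

/-- Functions in the ideal of `Δ` on an affine open set generate the stalks of the ideal. -/
theorem idealStalk_le_of_isAffineOpen {X Δ : CSch} {i : Δ ⟶ X} [IsClosedImmersion i.left] {V : X.left.Opens}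
    (hV : IsAffineOpen V) {x : X.left} (hx : x ∈ V) (J : Ideal (X.left.presheaf.stalk x))
    (hJ : ∀ a, i.left.app V a = 0 → X.left.presheaf.germ V x hx a ∈ J) : idealStalk i x ≤ J := by
  intro t ht
  obtain ⟨U, hxU, a, ha, rfl⟩ := (mem_idealStalk_iff i x t).1 ht
  obtain ⟨W, hW, hxW, hWU⟩ := exists_affine_nhd X.left (U ⊓ V) ⟨x, hxU, hx⟩
  have h1 := i.left.ker.map_ideal (U := ⟨W, hW⟩) (V := ⟨V, hV⟩) (hWU.trans inf_le_right)
  rw [Scheme.Hom.ker_apply, Scheme.Hom.ker_apply] at h1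
  have h2 : res X (hWU.trans inf_le_left) a ∈ RingHom.ker (i.left.app W).hom :=
    app_res_eq_zero i _ ha
  have h3 : RingHom.ker (i.left.app W).hom ≤ J.comap (X.left.presheaf.germ W x hxW).hom := by
    refine h1.symm.le.trans (Ideal.map_le_iff_le_comap.2 fun b hb => ?_)
    have := hJ b hb
    rw [← TopCat.Presheaf.germ_res_apply X.left.presheaf (homOfLE (hWU.trans inf_le_right)) x hxW b]
      at this
    exact this
  have h4 := h3 h2
  rw [← TopCat.Presheaf.germ_res_apply X.left.presheaf (homOfLE (hWU.trans inf_le_left)) x hxW a]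
  exact h4

/-- If a function in the ideal of `Δ` generates the ideal at a point, it does so nearby. -/
theorem exists_idealStalk_le {X Δ : CSch} {i : Δ ⟶ X} [IsLocallyNoetherian X.left]
    [IsClosedImmersion i.left] {W : X.left.Opens} {y : X.left}
    (hy : y ∈ W) (t : Γ(X.left, W))
    (ht : idealStalk i y ≤ Ideal.span {X.left.presheaf.germ W y hy t}) :
    ∃ (V : X.left.Opens) (hV : V ≤ W), y ∈ V ∧ ∀ z (hz : z ∈ V),
      idealStalk i z ≤ Ideal.span {X.left.presheaf.germ W z (hV hz) t} := by
  obtain ⟨V, hV, hyV, hVW⟩ := exists_affine_nhd X.left W ⟨y, hy⟩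
  have : IsNoetherianRing Γ(X.left, V) := IsLocallyNoetherian.component_noetherian ⟨V, hV⟩
  -- The ideal over an affine open is finitely generated; for each generator the divisibility
  -- relation between germs spreads out, and finitely many neighbourhoods are intersected.
  have key : ∀ (N : Submodule Γ(X.left, V) Γ(X.left, V)) (_ : N.FG),
      (∀ a ∈ N, X.left.presheaf.germ V y hyV a ∈ Ideal.span {X.left.presheaf.germ W y hy t}) →
      ∃ (V' : X.left.Opens) (hV' : V' ≤ V), y ∈ V' ∧ ∀ z (hz : z ∈ V'), ∀ a ∈ N,
        X.left.presheaf.germ V z (hV' hz) a ∈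
          Ideal.span {X.left.presheaf.germ W z (hVW (hV' hz)) t} := by
    refine Submodule.fg_induction (fun x hx => ?_) (fun N₁ N₂ _ _ h1 h2 h => ?_)
    · obtain ⟨c, hc⟩ := Ideal.mem_span_singleton.1 (hx x (Submodule.mem_span_singleton_self x))
      obtain ⟨U, hyU, c, rfl⟩ := X.left.presheaf.exists_germ_eq c
      let r₁ : V ⊓ U ≤ V := inf_le_left
      let r₂ : V ⊓ U ≤ U := inf_le_right
      have h1 : X.left.presheaf.germ (V ⊓ U) y ⟨hyV, hyU⟩ (res X r₁ x) =
          X.left.presheaf.germ (V ⊓ U) y ⟨hyV, hyU⟩ (res X (r₁.trans hVW) t * res X r₂ c) := by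
        rw [map_mul]
        refine (germ_res r₁ _ x).trans (hc.trans (congrArg₂ _ ?_ ?_))
        · exact (germ_res (r₁.trans hVW) _ t).symm
        · exact (germ_res r₂ _ c).symm
      obtain ⟨V', hyV', k, k', hk⟩ := X.left.presheaf.germ_eq y _ _ _ _ h1
      refine ⟨V', k.le.trans r₁, hyV', fun z hz a ha => ?_⟩
      obtain ⟨b, rfl⟩ := Submodule.mem_span_singleton.1 ha
      rw [smul_eq_mul, map_mul]
      refine Ideal.mul_mem_left _ _ (Ideal.mem_span_singleton.2
        ⟨X.left.presheaf.germ U z (r₂ (k.le hz)) c, ?_⟩)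
      have h2 := congrArg (X.left.presheaf.germ V' z hz) hk
      refine (germ_res r₁ (k.le hz) x).symm.trans
        ((TopCat.Presheaf.germ_res_apply X.left.presheaf k z hz _).symm.trans
        (h2.trans ((TopCat.Presheaf.germ_res_apply X.left.presheaf k' z hz _).trans
        ((map_mul _ _ _).trans (congrArg₂ _ ?_ ?_)))))
      · exact germ_res (r₁.trans hVW) _ t
      · exact germ_res r₂ _ c
    · obtain ⟨V₁, hV₁, hy₁, h1⟩ := h1 fun a ha => h a (Submodule.mem_sup_left ha)
      obtain ⟨V₂, hV₂, hy₂, h2⟩ := h2 fun a ha => h a (Submodule.mem_sup_right ha)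
      refine ⟨V₁ ⊓ V₂, inf_le_left.trans hV₁, ⟨hy₁, hy₂⟩, fun z hz a ha => ?_⟩
      obtain ⟨b, hb, c, hc, rfl⟩ := Submodule.mem_sup.1 ha
      rw [map_add]
      exact add_mem (h1 z hz.1 b hb) (h2 z hz.2 c hc)
  obtain ⟨V', hV', hy', h⟩ := key _ (IsNoetherian.noetherian (RingHom.ker (i.left.app V).hom))
    fun a ha => ht (germ_mem_idealStalk i hyV ha)
  exact ⟨V', hV'.trans hVW, hy', fun z hz =>
    idealStalk_le_of_isAffineOpen hV (hV' hz) _ fun a ha => h z hz a ha⟩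

section Logarithmic

variable {X Δ : CSch} [IsIntegral X.left] {i : Δ ⟶ X}

theorem contraction_D_germ (δ : VectorField X) {U : X.left.Opens} {x : X.left} (hx : x ∈ U)
    (a : Γ(X.left, U)) :
    contraction δ (KaehlerDifferential.D ℂ X.left.functionField
      (algebraMap (X.left.presheaf.stalk x) _ (X.left.presheaf.germ U x hx a))) =
    algebraMap (X.left.presheaf.stalk x) _ (X.left.presheaf.germ U x hx (δ.1 U a)) := by
  have : Nonempty U := ⟨⟨x, hx⟩⟩
  rw [← germ_functionField U x hx, ← germ_functionField U x hx, contraction_D]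

theorem exists_contraction_D_eq (δ : VectorField X) {x : X.left} (s : X.left.presheaf.stalk x) :
    ∃ s' : X.left.presheaf.stalk x,
      contraction δ (KaehlerDifferential.D ℂ X.left.functionField (algebraMap _ _ s)) =
        algebraMap _ _ s' := by
  obtain ⟨U, hx, a, rfl⟩ := X.left.presheaf.exists_germ_eq s
  exact ⟨_, contraction_D_germ δ hx a⟩

theorem PreservesIdeal.exists_contraction_D_eq {δ : VectorField X} (h : PreservesIdeal i δ)
    {x : X.left} {s : X.left.presheaf.stalk x} (hs : s ∈ idealStalk i x) :
    ∃ s' ∈ idealStalk i x,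
      contraction δ (KaehlerDifferential.D ℂ X.left.functionField (algebraMap _ _ s)) =
        algebraMap _ _ s' := by
  obtain ⟨U, hx, a, ha, rfl⟩ := (mem_idealStalk_iff i x _).1 hs
  exact ⟨_, germ_mem_idealStalk i hx (h U a ha), contraction_D_germ δ hx a⟩

theorem contraction_smul_stalk (δ : VectorField X) {x : X.left} (s : X.left.presheaf.stalk x)
    (ω : RatForm X) :
    contraction δ (s • ω) = algebraMap _ X.left.functionField s * contraction δ ω := by
  rw [← algebraMap_smul X.left.functionField s ω, map_smul, smul_eq_mul]

theorem algebraMap_stalk_injective (x : X.left) :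
    Function.Injective (algebraMap (X.left.presheaf.stalk x) X.left.functionField) :=
  IsFractionRing.injective _ _

/-- On `df/f` the contraction is `δf / f`. This is clear for a unit `f`. Otherwise the point is
generic on `Δ`, where the ideal `I` of `Δ` is maximal: `f ∈ I` gives `δf ∈ I`, and `I ⊆ (f)`. -/
theorem PreservesIdeal.contraction_mem_range_stalk {δ : VectorField X} (h : PreservesIdeal i δ)
    (hi : IsReducedDivisor i) {x : X.left} (hx : Order.coheight x ≤ 1) {ω : RatForm X}
    (hω : ω ∈ logFormStalk i x) :
    contraction δ ω ∈ (algebraMap (X.left.presheaf.stalk x) X.left.functionField).range := by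
  have := hi.isClosedImmersion
  have := hi.isReduced
  unfold logFormStalk at hω
  induction hω using Submodule.span_induction with
  | mem ω hω =>
    obtain ⟨a, rfl⟩ | ⟨f, hf0, hf, rfl⟩ := hω
    · obtain ⟨s', hs'⟩ := LogAut.exists_contraction_D_eq δ a
      exact ⟨s', hs'.symm⟩
    · have key : ∃ f' : X.left.presheaf.stalk x, f' ∈ Ideal.span {f} ∧
          contraction δ (KaehlerDifferential.D ℂ X.left.functionField (algebraMap _ _ f)) =
            algebraMap _ _ f' := by
        by_cases hu : IsUnit f
        · obtain ⟨f', hf'⟩ := LogAut.exists_contraction_D_eq δ f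
          refine ⟨f', ?_, hf'⟩
          rw [Ideal.span_singleton_eq_top.2 hu]
          trivial
        · have hx' : x ∈ Set.range i.left := by
            by_contra hx'
            rw [idealStalk_eq_top i hx', top_le_iff, Ideal.span_singleton_eq_top] at hf
            exact hu hf
          obtain ⟨ξ, hξ, rfl⟩ := hi.exists_genericPoint hx hx'
          have hfm : f ∈ idealStalk i (i.left ξ) := by
            rw [idealStalk_genericPoints i hξ]
            exact hu
          obtain ⟨f', hf', he⟩ := h.exists_contraction_D_eq hfm
          exact ⟨f', hf hf', he⟩
      obtain ⟨f', hf', he⟩ := key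
      obtain ⟨c, rfl⟩ := Ideal.mem_span_singleton.1 hf'
      refine ⟨c, ?_⟩
      rw [map_smul, he, smul_eq_mul, map_mul, inv_mul_cancel_left₀]
      exact (map_ne_zero_iff _ (algebraMap_stalk_injective x)).2 hf0
  | zero => rw [map_zero]; exact zero_mem _
  | add ω ω' _ _ h1 h2 => rw [map_add]; exact add_mem h1 h2
  | smul s ω _ h1 => rw [contraction_smul_stalk]; exact mul_mem ⟨s, rfl⟩ h1

variable [IsLocallyNoetherian X.left]

/-- Points of codimension at most one are log smooth, so `ω` is logarithmic there; normality extends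
the contraction over the remaining points. -/
theorem PreservesIdeal.contraction_mem_range
    (hX : ∀ x : X.left, IsIntegrallyClosed (X.left.presheaf.stalk x)) {δ : VectorField X}
    (h : PreservesIdeal i δ) (hi : IsReducedDivisor i) (U : X.left.Opens) [Nonempty U]
    {ω : RatForm X} (hω : ω ∈ logForm i U) :
    contraction δ ω ∈ (algebraMap Γ(X.left, U) X.left.functionField).range :=
  mem_range_algebraMap_of_coheight_le_one hX U _ fun x hx hx1 =>
    h.contraction_mem_range_stalk hi hx1 (hω x hx (isLogSmoothAt_of_coheight_le_one hX hi hx1))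

/-- The logarithmic vector field given by contraction with a vector field that preserves the ideal
of `Δ`. -/
theorem PreservesIdeal.exists_logVectorField
    (hX : ∀ x : X.left, IsIntegrallyClosed (X.left.presheaf.stalk x)) {δ : VectorField X}
    (h : PreservesIdeal i δ) (hi : IsReducedDivisor i) :
    ∃ φ : LogVectorField i, toVectorField i φ = δ := by
  choose c hc using fun (U : NEOpens X) (ω : logForm i U.1) =>
    h.contraction_mem_range hX hi U.1 ω.2
  let φ : LogVectorField i := ⟨fun U =>
    { toFun := c U
      map_add' := fun ω ω' => algebraMap_functionField_injective U.1 <| by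
        rw [map_add, hc, hc, hc, ← map_add]
        rfl
      map_smul' := fun a ω => algebraMap_functionField_injective U.1 <| by
        rw [RingHom.id_apply, smul_eq_mul, map_mul, hc, hc, ← contraction_smul]
        rfl }, fun U V hVU ω => algebraMap_functionField_injective V.1 <| by
        rw [algebraMap_res]
        exact (hc V _).trans (hc U ω).symm⟩
  refine ⟨φ, Subtype.ext (funext fun U => Derivation.ext fun a => ?_)⟩
  by_cases hU : Nonempty U
  · rw [toVectorField_apply]
    apply algebraMap_functionField_injective U
    exact (hc ⟨U, hU⟩ _).trans (contraction_D δ U a)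
  · have hU' : U = ⊥ := by
      ext x
      exact ⟨fun hx => (hU ⟨x, hx⟩).elim, fun hx => hx.elim⟩
    subst hU'
    exact Subsingleton.elim _ _

end Logarithmic

/-! ### Logarithmic vector fields preserve the ideal of `Δ` -/

/-- The quotient is `φ(dt/t)`. The divisibility hypothesis is needed at every point of `V` for
`dt/t` to be a section of the logarithmic forms over `V`. -/
theorem exists_toVectorField_eq_mul {X Δ : CSch} [IsIntegral X.left] {i : Δ ⟶ X}
    (φ : LogVectorField i) {V : X.left.Opens} [hne : Nonempty V]
    {t : Γ(X.left, V)} (ht0 : t ≠ 0)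
    (ht : ∀ z (hz : z ∈ V), idealStalk i z ≤ Ideal.span {X.left.presheaf.germ V z hz t}) :
    ∃ g, (toVectorField i φ).1 V t = t * g := by
  have hK : algebraMap Γ(X.left, V) X.left.functionField t ≠ 0 :=
    (map_ne_zero_iff _ (algebraMap_functionField_injective V)).2 ht0
  have hω : (algebraMap Γ(X.left, V) X.left.functionField t)⁻¹ •
      KaehlerDifferential.D ℂ X.left.functionField (algebraMap _ _ t) ∈ logForm i V := by
    intro z hz _
    rw [germ_functionField V z hz] at hK ⊢
    exact Submodule.subset_span (Or.inr ⟨_, fun h0 => hK (by rw [h0, map_zero]), ht z hz, rfl⟩)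
  refine ⟨φ.1 ⟨V, hne⟩ ⟨_, hω⟩, algebraMap_functionField_injective V ?_⟩
  rw [map_mul]
  refine Eq.trans ?_ (congrArg _ (algebraMap_logVectorField_apply i φ ⟨V, hne⟩ ⟨_, hω⟩)).symm
  rw [map_smul, smul_eq_mul, mul_inv_cancel_left₀ hK, contraction_D]

section Preserve

variable {X Δ : CSch} [IsIntegral X.left] [IsLocallyNoetherian X.left] {i : Δ ⟶ X}

theorem not_isField_stalk_of_coheight_eq_one {Y : Scheme} {y : Y} (hy : Order.coheight y = 1) :
    ¬ IsField (Y.presheaf.stalk y) := fun h => by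
  have hd := ringKrullDim_stalk_eq_coheight y
  rw [hy, ringKrullDim_eq_zero_of_isField h] at hd
  have h01 : (0 : ℕ∞) = 1 := WithBot.coe_inj.1 hd
  exact zero_ne_one h01

theorem exists_idealStalk_eq_span
    (hX : ∀ x : X.left, IsIntegrallyClosed (X.left.presheaf.stalk x)) {y : X.left}
    (hy : Order.coheight y = 1)
    (hm : idealStalk i y = IsLocalRing.maximalIdeal (X.left.presheaf.stalk y)) :
    ∃ (W : X.left.Opens) (hyW : y ∈ W) (t : Γ(X.left, W)),
      X.left.presheaf.germ W y hyW t ≠ 0 ∧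
      idealStalk i y = Ideal.span {X.left.presheaf.germ W y hyW t} := by
  have := isPrincipalIdealRing_stalk hX hy.le
  obtain ⟨ϖ, hϖ⟩ := (IsPrincipalIdealRing.principal (idealStalk i y)).principal
  replace hϖ : idealStalk i y = Ideal.span {ϖ} := hϖ
  have hϖ0 : ϖ ≠ 0 := by
    rintro rfl
    rw [Ideal.span_singleton_eq_bot.2 rfl, hm] at hϖ
    exact not_isField_stalk_of_coheight_eq_one hy (IsLocalRing.isField_iff_maximalIdeal_eq.2 hϖ)
  obtain ⟨W, hyW, t, rfl⟩ := X.left.presheaf.exists_germ_eq ϖ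
  exact ⟨W, hyW, t, hϖ0, hϖ⟩

/-- Near `y` the ideal is generated by one function `t`. If `a = t c`, then `∂a = t ∂c + c ∂t`, and
`∂t` is a multiple of `t`. -/
theorem germ_toVectorField_mem_idealStalk
    (hX : ∀ x : X.left, IsIntegrallyClosed (X.left.presheaf.stalk x)) [IsClosedImmersion i.left]
    (φ : LogVectorField i) {y : X.left} (hy : Order.coheight y = 1)
    (hm : idealStalk i y = IsLocalRing.maximalIdeal (X.left.presheaf.stalk y)) {U : X.left.Opens}
    (hU : y ∈ U) {a : Γ(X.left, U)} (ha : i.left.app U a = 0) :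
    X.left.presheaf.germ U y hU ((toVectorField i φ).1 U a) ∈ idealStalk i y := by
  obtain ⟨W, hyW, t, hϖ0, hϖ⟩ := exists_idealStalk_eq_span hX hy hm
  obtain ⟨V, hVW, hyV, hV⟩ := exists_idealStalk_le hyW t hϖ.le
  have hne : Nonempty V := ⟨⟨y, hyV⟩⟩
  rw [← germ_res hVW hyV] at hϖ hϖ0
  obtain ⟨g, hg⟩ := exists_toVectorField_eq_mul φ (t := res X hVW t)
    (fun h0 => hϖ0 (by rw [h0, map_zero])) fun z hz => by
      rw [germ_res hVW hz]
      exact hV z hz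
  generalize toVectorField i φ = δ at *
  have hay := germ_mem_idealStalk i hU ha
  rw [hϖ] at hay ⊢
  obtain ⟨c, hc⟩ := Ideal.mem_span_singleton.1 hay
  obtain ⟨c', hc'⟩ := exists_contraction_D_eq δ c
  have h1 := contraction_D_germ δ hU a
  have h2 := contraction_D_germ δ hyV (res X hVW t)
  rw [hg, map_mul] at h2
  rw [hc] at h1
  generalize X.left.presheaf.germ V y hyV (res X hVW t) = ϖ at *
  generalize X.left.presheaf.germ V y hyV g = γ at *
  generalize X.left.presheaf.germ U y hU (δ.1 U a) = b at *
  rw [map_mul, Derivation.leibniz, map_add, map_smul, map_smul, hc', h2, smul_eq_mul,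
    smul_eq_mul] at h1
  refine Ideal.mem_span_singleton.2 ⟨c' + c * γ, algebraMap_stalk_injective y ?_⟩
  rw [← h1]
  simp only [map_mul, map_add]
  ring

/-- On the reduced scheme `Δ` a function is zero if its basic open set is empty. A nonempty open set
contains a generic point of `Δ`, where the function has zero germ. -/
theorem toVectorField_preservesIdeal
    (hX : ∀ x : X.left, IsIntegrallyClosed (X.left.presheaf.stalk x)) (hi : IsReducedDivisor i)
    (φ : LogVectorField i) : PreservesIdeal i (toVectorField i φ) := fun U a ha => by
  have := hi.isClosedImmersion
  have := hi.isReduced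
  rw [← basicOpen_eq_bot_iff]
  by_contra hne
  obtain ⟨ξ, hb, hξ⟩ : (((Δ.left.basicOpen (i.left.app U ((toVectorField i φ).1 U a)) :
      Δ.left.Opens) : Set Δ.left) ∩ genericPoints Δ.left).Nonempty := by
    refine (dense_iff_closure_eq.2 genericPoints.closure).inter_open_nonempty _
      (Δ.left.basicOpen _).isOpen ?_
    exact (TopologicalSpace.Opens.ne_bot_iff_nonempty _).1 hne
  have hξU : i.left ξ ∈ U := Δ.left.basicOpen_le _ hb
  have hu := (Scheme.mem_basicOpen Δ.left _ ξ hξU).1 hb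
  have h0 := germ_toVectorField_mem_idealStalk hX φ (hi.codim_one ξ hξ)
    (idealStalk_genericPoints i hξ) hξU ha
  rw [idealStalk_eq_ker, RingHom.mem_ker] at h0
  have h1 := (germ_app i.left U ξ hξU _).symm.trans h0
  rw [h1] at hu
  exact not_isUnit_zero hu

/-- The isomorphism of `Lie(A_{X,Δ})` with the space of logarithmic vector fields. -/
theorem exists_lie_equiv
    (hX : ∀ x : X.left, IsIntegrallyClosed (X.left.presheaf.stalk x)) (hi : IsReducedDivisor i) :
    ∃ e : lie i ≃ LogVectorField i,
      (∀ σ, IsOnePlusEps σ.1 (toVectorField i (e σ))) ∧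
      (∀ σ τ, e (σ * τ) = e σ + e τ) ∧
      ∀ (c : ℂ) (σ), e (lieScale i c σ) = c • e σ := by
  have := hi.isClosedImmersion
  -- Both sides are identified with the ideal-preserving derivations, and linearity is tested there.
  let E : LogVectorField i → PreservingField i := fun φ =>
    ⟨toVectorField i φ, toVectorField_preservesIdeal hX hi φ⟩
  have hE : Function.Bijective E :=
    ⟨fun φ ψ h => toVectorField_injective i (congrArg Subtype.val h), fun δ =>
      (δ.2.exists_logVectorField hX hi).imp fun φ hφ => Subtype.ext hφ⟩
  let e : lie i ≃ LogVectorField i :=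
    (Equiv.ofBijective _ (lieToField_bijective i)).trans (Equiv.ofBijective E hE).symm
  have he : ∀ σ, IsOnePlusEps σ.1 (toVectorField i (e σ)) := fun σ => by
    have h : E (e σ) = lieToField i σ := (Equiv.ofBijective E hE).apply_symm_apply _
    have h' : toVectorField i (e σ) = (lieToField i σ).1 := congrArg Subtype.val h
    rw [h']
    exact lieToField_spec i σ
  refine ⟨e, he, fun σ τ => toVectorField_injective i ?_, fun c σ => toVectorField_injective i ?_⟩
  · rw [map_add]
    exact (he (σ * τ)).unique ((he σ).mul (he τ))
  · rw [map_smul]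
    exact (he (lieScale i c σ)).unique ((he σ).autBaseChange_scale c)

end Preserve

/-! ### Tangent vectors and homomorphisms to the dual numbers -/

section LocalAlgebra

open IsLocalRing TrivSqZeroExt

theorem map_smul_cotangent {R : Type*} [CommRing R] [IsLocalRing R]
    (v : Module.Dual (ResidueField R) (CotangentSpace R)) (r : R) (x : CotangentSpace R) :
    v (r • x) = residue R r * v x := by
  rw [← algebraMap_smul (ResidueField R) r x, map_smul, smul_eq_mul]
  rfl

variable {R : Type*} [CommRing R] [IsLocalRing R] [Algebra ℂ R] (ev : R →ₐ[ℂ] ℂ)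

theorem mem_maximalIdeal_iff_eval {a : R} : a ∈ maximalIdeal R ↔ ev a = 0 := by
  have : RingHom.ker ev = maximalIdeal R :=
    eq_maximalIdeal (RingHom.ker_isMaximal_of_surjective ev fun c => ⟨algebraMap ℂ R c, by simp⟩)
  rw [← this, RingHom.mem_ker]

/-- The homomorphism from the residue field given by a rational point. -/
def residueEval : ResidueField R →+* ℂ :=
  Ideal.Quotient.lift _ ev.toRingHom fun _ ha => (mem_maximalIdeal_iff_eval ev).1 ha

theorem residueEval_residue (a : R) : residueEval ev (residue R a) = ev a := rfl

theorem residueEval_algebraMap (c : ℂ) :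
    residueEval ev (algebraMap ℂ (ResidueField R) c) = c :=
  (residueEval_residue ev (algebraMap ℂ R c)).trans (ev.commutes c)

/-- `residueEval` is injective, as a homomorphism of fields, and has a section, so the residue field
is `ℂ`. -/
theorem algebraMap_residueEval (x : ResidueField R) :
    algebraMap ℂ (ResidueField R) (residueEval ev x) = x :=
  (residueEval ev).injective (residueEval_algebraMap ev _)

/-- The element `a - a(p)` of the maximal ideal at a rational point `p`. -/
def subEval (a : R) : maximalIdeal R :=
  ⟨a - algebraMap ℂ R (ev a), (mem_maximalIdeal_iff_eval ev).2 (by simp)⟩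

theorem subEval_of_mem (a : maximalIdeal R) : subEval ev a.1 = a :=
  Subtype.ext (by simp [subEval, (mem_maximalIdeal_iff_eval ev).1 a.2])

variable (v : Module.Dual (ResidueField R) (CotangentSpace R))

/-- The derivation at a rational point `p` given by a tangent vector. -/
def pointDerivation (a : R) : ℂ :=
  residueEval ev (v ((maximalIdeal R).toCotangent (subEval ev a)))

theorem pointDerivation_add (a b : R) :
    pointDerivation ev v (a + b) = pointDerivation ev v a + pointDerivation ev v b := by
  have : subEval ev (a + b) = subEval ev a + subEval ev b := Subtype.ext (by
    simp only [subEval, map_add, Submodule.coe_add]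
    ring)
  rw [pointDerivation, this, map_add, map_add, map_add]
  rfl

/-- Write `ab - a(p)b(p) = a (b - b(p)) + b(p) (a - a(p))`; on the cotangent space `a` acts through
`a(p)`. -/
theorem pointDerivation_mul (a b : R) :
    pointDerivation ev v (a * b) =
      ev a * pointDerivation ev v b + ev b * pointDerivation ev v a := by
  have : subEval ev (a * b) = a • subEval ev b + algebraMap ℂ R (ev b) • subEval ev a :=
    Subtype.ext (by
      simp only [subEval, map_mul, Submodule.coe_add, Submodule.coe_smul, smul_eq_mul]
      ring)
  rw [pointDerivation, this, map_add, map_add, LinearMap.map_smul (maximalIdeal R).toCotangent,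
    LinearMap.map_smul (maximalIdeal R).toCotangent, map_smul_cotangent, map_smul_cotangent,
    map_add, map_mul, map_mul, residueEval_residue, residueEval_residue]
  simp [pointDerivation]

theorem pointDerivation_algebraMap (c : ℂ) : pointDerivation ev v (algebraMap ℂ R c) = 0 := by
  have : subEval ev (algebraMap ℂ R c) = 0 := Subtype.ext (by simp [subEval])
  rw [pointDerivation, this, map_zero, map_zero, map_zero]

/-- The homomorphism `a ↦ a(p) + v(a - a(p)) ε` given by a tangent vector `v`. -/
def tangentHom : R →ₐ[ℂ] DualNumber ℂ where
  toFun a := inl (ev a) + inr (pointDerivation ev v a)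
  map_one' := by
    have := pointDerivation_algebraMap ev v 1
    rw [map_one] at this
    ext <;> simp [this]
  map_zero' := by
    have := pointDerivation_algebraMap ev v 0
    rw [map_zero] at this
    ext <;> simp [this]
  map_add' a b := by ext <;> simp [pointDerivation_add]
  map_mul' a b := by ext <;> simp [pointDerivation_mul, mul_comm]
  commutes' c := by
    ext <;> simp [pointDerivation_algebraMap, algebraMap_eq_inl']

@[simp]
theorem fst_tangentHom (a : R) : (tangentHom ev v a).fst = ev a := by simp [tangentHom]

@[simp]
theorem snd_tangentHom (a : R) : (tangentHom ev v a).snd = pointDerivation ev v a := by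
  simp [tangentHom]

theorem pointDerivation_of_mem (a : maximalIdeal R) :
    algebraMap ℂ (ResidueField R) (pointDerivation ev v a.1) =
      v ((maximalIdeal R).toCotangent a) := by
  rw [pointDerivation, algebraMap_residueEval, subEval_of_mem]

theorem tangentHom_of_mem (a : maximalIdeal R) :
    tangentHom ev v a.1 = pointDerivation ev v a.1 • (DualNumber.eps : DualNumber ℂ) := by
  ext <;> simp [(mem_maximalIdeal_iff_eval ev).1 a.2]

theorem tangentHom_injective : Function.Injective (tangentHom ev) := fun v w h => by
  refine LinearMap.ext fun x => ?_
  obtain ⟨a, rfl⟩ := (maximalIdeal R).toCotangent_surjective x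
  have := congrArg snd (DFunLike.congr_fun h a.1)
  rw [snd_tangentHom, snd_tangentHom] at this
  exact (pointDerivation_of_mem ev v a).symm.trans
    ((congrArg _ this).trans (pointDerivation_of_mem ev w a))

/-- On the maximal ideal `φ` takes values in `ℂ ε`, so it kills products of two elements and its
coefficient descends to the cotangent space. -/
theorem exists_tangentHom_eq (φ : R →ₐ[ℂ] DualNumber ℂ) (hφ : ∀ a, (φ a).fst = ev a) :
    ∃ v, tangentHom ev v = φ := by
  let f : maximalIdeal R →ₗ[R] ResidueField R :=
    { toFun := fun a => algebraMap ℂ (ResidueField R) (φ a.1).snd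
      map_add' := fun a b => by simp
      map_smul' := fun r a => (residueEval ev).injective (by
        have : residueEval ev (r • algebraMap ℂ (ResidueField R) (φ a.1).snd) =
            ev r * (φ a.1).snd := by
          rw [Algebra.smul_def, map_mul, residueEval_algebraMap]
          rfl
        rw [RingHom.id_apply, this, residueEval_algebraMap]
        simp [hφ, (mem_maximalIdeal_iff_eval ev).1 a.2]) }
  let F : CotangentSpace R →ₗ[R] ResidueField R := Ideal.Cotangent.lift f fun a b => by
    change algebraMap ℂ (ResidueField R) (φ (a.1 * b.1)).snd = 0
    simp [hφ, (mem_maximalIdeal_iff_eval ev).1 a.2, (mem_maximalIdeal_iff_eval ev).1 b.2]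
  let v : Module.Dual (ResidueField R) (CotangentSpace R) :=
    -- Linearity over `R` is linearity over the residue field because `R` surjects onto it.
    LinearMap.extendScalarsOfSurjective (R := R) residue_surjective F
  refine ⟨v, AlgHom.ext fun a => ?_⟩
  have h1 := pointDerivation_of_mem ev v (subEval ev a)
  have h2 : v ((maximalIdeal R).toCotangent (subEval ev a)) =
    algebraMap ℂ (ResidueField R) (φ (a - algebraMap ℂ R (ev a))).snd := rfl
  have h3 : pointDerivation ev v a = (φ (a - algebraMap ℂ R (ev a))).snd := by
    rw [pointDerivation, h2, residueEval_algebraMap]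
  ext
  · simp [hφ]
  · rw [snd_tangentHom, h3]
    simp [algebraMap_eq_inl']

theorem pointDerivation_add_left (w : Module.Dual (ResidueField R) (CotangentSpace R)) (a : R) :
    pointDerivation ev (v + w) a = pointDerivation ev v a + pointDerivation ev w a := by
  rw [pointDerivation, LinearMap.add_apply, map_add]
  rfl

theorem pointDerivation_smul_left (c : ℂ) (a : R) :
    pointDerivation ev (c • v) a = c * pointDerivation ev v a := by
  rw [pointDerivation, LinearMap.smul_apply, Algebra.smul_def, map_mul, residueEval_algebraMap]
  rfl

end LocalAlgebra

/-! ### Points with values in local algebras -/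

/-- The structure morphism factors through the spectrum of the global sections, whose map to the
stalk is the germ. -/
theorem fromSpecStalk_hom {G : CSch} (y : G.left) :
    G.left.fromSpecStalk y ≫ G.hom =
      Spec.map (CommRingCat.ofHom (algebraMap ℂ (G.left.presheaf.stalk y))) := by
  have h1 : G.hom = G.left.toSpecΓ ≫
      Spec.map ((Scheme.ΓSpecIso (CommRingCat.of ℂ)).inv ≫ G.hom.appTop) := by
    rw [Spec.map_comp, ← Scheme.toSpecΓ_naturality_assoc, ← SpecMap_ΓSpecIso_hom,
      ← Spec.map_comp, Iso.inv_hom_id, Spec.map_id]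
    exact (Category.comp_id _).symm
  rw [h1, Scheme.fromSpecStalk_toSpecΓ_assoc, ← Spec.map_comp]
  congr 1
  refine ConcreteCategory.hom_ext _ _ fun c => ?_
  exact congrArg (G.left.presheaf.germ ⊤ y trivial).hom
    (ConcreteCategory.congr_hom (Scheme.Hom.appLE_eq_app G.hom (U := ⊤)).symm
      ((Scheme.ΓSpecIso (CommRingCat.of ℂ)).inv c))

theorem exists_fromSpecStalk {Y : Scheme} {S : CommRingCat} [IsLocalRing S] (f : Spec S ⟶ Y)
    {y : Y} (hy : f (IsLocalRing.closedPoint S) = y) :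
    ∃ φ : Y.presheaf.stalk y ⟶ S, f = Spec.map φ ≫ Y.fromSpecStalk y := by
  subst hy
  exact ⟨Scheme.stalkClosedPointTo f, (Scheme.Spec_stalkClosedPointTo_fromSpecStalk f).symm⟩

theorem SpecMap_fromSpecStalk_injective {Y : Scheme} {S : CommRingCat} {y : Y}
    {φ ψ : Y.presheaf.stalk y ⟶ S}
    (h : Spec.map φ ≫ Y.fromSpecStalk y = Spec.map ψ ≫ Y.fromSpecStalk y) : φ = ψ :=
  Spec.map_injective ((cancel_mono _).1 h)

/-- The spectrum of a `ℂ`-algebra. -/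
abbrev specAlg (S : Type) [CommRing S] [Algebra ℂ S] : CSch :=
  Over.mk (Spec.map (CommRingCat.ofHom (algebraMap ℂ S)))

/-- The morphism of spectra given by a homomorphism of `ℂ`-algebras. -/
def specAlgMap {S T : Type} [CommRing S] [Algebra ℂ S] [CommRing T] [Algebra ℂ T]
    (ψ : S →ₐ[ℂ] T) : specAlg T ⟶ specAlg S :=
  Over.homMk (Spec.map (CommRingCat.ofHom ψ.toRingHom)) (by
    change Spec.map _ ≫ Spec.map _ = Spec.map _
    rw [← Spec.map_comp]
    congr 1
    exact ConcreteCategory.hom_ext _ _ fun c => ψ.commutes c)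

section Stalk

variable {G : CSch} {y : G.left} {S T : Type} [CommRing S] [Algebra ℂ S] [CommRing T] [Algebra ℂ T]

/-- The point of `G` given by a homomorphism from the local ring at `y`. -/
def stalkPoint (φ : G.left.presheaf.stalk y →ₐ[ℂ] S) : specAlg S ⟶ G :=
  Over.homMk (Spec.map (CommRingCat.ofHom φ.toRingHom) ≫ G.left.fromSpecStalk y) (by
    rw [Category.assoc, fromSpecStalk_hom, ← Spec.map_comp]
    change _ = Spec.map _
    congr 1
    exact ConcreteCategory.hom_ext _ _ fun c => φ.commutes c)

theorem specAlgMap_stalkPoint (φ : G.left.presheaf.stalk y →ₐ[ℂ] S) (ψ : S →ₐ[ℂ] T) :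
    specAlgMap ψ ≫ stalkPoint φ = stalkPoint (ψ.comp φ) := by
  apply Over.OverMorphism.ext
  change Spec.map _ ≫ Spec.map _ ≫ _ = Spec.map _ ≫ _
  rw [← Category.assoc, ← Spec.map_comp]
  rfl

theorem stalkPoint_injective {φ ψ : G.left.presheaf.stalk y →ₐ[ℂ] S}
    (h : stalkPoint φ = stalkPoint ψ) : φ = ψ := by
  have h1 := SpecMap_fromSpecStalk_injective (congrArg CommaMorphism.left h)
  exact AlgHom.ext fun a => ConcreteCategory.congr_hom h1 a

theorem exists_stalkPoint [IsLocalRing S] (f : specAlg S ⟶ G)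
    (hy : f.left (IsLocalRing.closedPoint S) = y) :
    ∃ φ : G.left.presheaf.stalk y →ₐ[ℂ] S, stalkPoint φ = f := by
  obtain ⟨φ, hφ⟩ := exists_fromSpecStalk (S := CommRingCat.of S) f.left hy
  have h1 := Over.w f
  rw [hφ, Category.assoc, fromSpecStalk_hom, ← Spec.map_comp] at h1
  have h2 := Spec.map_injective h1
  refine ⟨{ φ.hom with commutes' := fun c => ConcreteCategory.congr_hom h2 c }, ?_⟩
  exact Over.OverMorphism.ext hφ.symm

end Stalk

/-- Evaluation at a `ℂ`-valued point. -/
theorem exists_eval {G : CSch} (p : pt ⟶ G) : ∃ ev : LocalRingAt p →ₐ[ℂ] ℂ,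
    p.left = Spec.map (CommRingCat.ofHom ev.toRingHom) ≫ G.left.fromSpecStalk (pointOf p) := by
  obtain ⟨φ, hφ⟩ := exists_fromSpecStalk (S := CommRingCat.of ℂ) p.left (y := pointOf p) rfl
  have h1 := Over.w p
  rw [hφ, Category.assoc, fromSpecStalk_hom, ← Spec.map_comp] at h1
  have h2 := Spec.map_injective (h1.trans (Spec.map_id _).symm)
  exact ⟨{ φ.hom with commutes' := fun c => ConcreteCategory.congr_hom h2 c }, hφ⟩

/-- Both points factor through the spectrum of the local ring, whose map to `G` is a monomorphism.
-/
theorem dualZero_stalkPoint_iff {G : CSch} {p : pt ⟶ G} {ev : LocalRingAt p →ₐ[ℂ] ℂ}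
    (hev : p.left = Spec.map (CommRingCat.ofHom ev.toRingHom) ≫ G.left.fromSpecStalk (pointOf p))
    (φ : LocalRingAt p →ₐ[ℂ] DualNumber ℂ) :
    dualZero ≫ (stalkPoint φ : dual ⟶ G) = p ↔ ∀ a, (φ a).fst = ev a := by
  have h0 : (dualZero ≫ (stalkPoint φ : dual ⟶ G)).left =
      Spec.map (CommRingCat.ofHom ((TrivSqZeroExt.fstHom ℂ ℂ ℂ).comp φ).toRingHom) ≫
        G.left.fromSpecStalk (pointOf p) := by
    change Spec.map _ ≫ Spec.map _ ≫ _ = Spec.map _ ≫ _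
    rw [← Category.assoc, ← Spec.map_comp]
    rfl
  constructor
  · intro h a
    have h1 := congrArg CommaMorphism.left h
    have h2 := SpecMap_fromSpecStalk_injective (h0.symm.trans (h1.trans hev))
    exact ConcreteCategory.congr_hom h2 a
  · intro h
    apply Over.OverMorphism.ext
    rw [h0, hev]
    congr 3
    exact RingHom.ext h

theorem left_closedPoint_of_dualZero {G : CSch} {p : pt ⟶ G} {f : dual ⟶ G}
    (hf : dualZero ≫ f = p) : f.left (IsLocalRing.closedPoint (DualNumber ℂ)) = pointOf p := by
  have : Subsingleton dual.left := subsingleton_dual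
  subst hf
  exact congrArg f.left (Subsingleton.elim _ (dualZero.left (IsLocalRing.closedPoint ℂ)))

/-! ### The tangent space of a scheme that represents `A_{X,Δ}` -/

section SquareZero

open TrivSqZeroExt

variable {M N : Type} [AddCommGroup M] [Module ℂ M] [AddCommGroup N] [Module ℂ N]
  [Module ℂᵐᵒᵖ M] [IsCentralScalar ℂ M] [Module ℂᵐᵒᵖ N] [IsCentralScalar ℂ N]

instance isLocalRing_trivSqZeroExt : IsLocalRing (TrivSqZeroExt ℂ M) :=
  .of_isUnit_or_isUnit_one_sub_self fun a => by
    rw [isUnit_iff_isUnit_fst, isUnit_iff_isUnit_fst, fst_sub, fst_one]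
    exact IsLocalRing.isUnit_or_isUnit_one_sub_self _

theorem specAlgMap_map_closedPoint (f : M →ₗ[ℂ] N) :
    (specAlgMap (map f)).left (IsLocalRing.closedPoint (TrivSqZeroExt ℂ N)) =
      IsLocalRing.closedPoint (TrivSqZeroExt ℂ M) := by
  have : IsLocalHom (map f).toRingHom := ⟨fun a ha => by
    rw [isUnit_iff_isUnit_fst] at ha ⊢
    have h := fst_map f a
    exact h ▸ ha⟩
  exact IsLocalRing.comap_closedPoint (map f).toRingHom

/-- The endomorphism of `Spec ℂ[ε]` given by an endomorphism of `ℂ ε`. -/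
def dualEnd (f : ℂ →ₗ[ℂ] ℂ) : dual ⟶ dual := specAlgMap (map f)

/-- The projection to `Spec ℂ[ε]` given by a vector. -/
def toDual (f : ℂ →ₗ[ℂ] M) : specAlg (TrivSqZeroExt ℂ M) ⟶ dual := specAlgMap (map f)

/-- The inclusion of `Spec ℂ[ε]` given by a linear form. -/
def ofDual (g : M →ₗ[ℂ] ℂ) : dual ⟶ specAlg (TrivSqZeroExt ℂ M) := specAlgMap (map g)

/-- The point with values in `ℂ[ε]` given by a homomorphism from the local ring at `y`. -/
def dualPoint {G : CSch} {y : G.left} (φ : G.left.presheaf.stalk y →ₐ[ℂ] DualNumber ℂ) :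
    dual ⟶ G := stalkPoint φ

theorem ofDual_toDual (f : ℂ →ₗ[ℂ] M) (g : M →ₗ[ℂ] ℂ) :
    ofDual g ≫ toDual f = dualEnd (g.comp f) := by
  apply Over.OverMorphism.ext
  change Spec.map _ ≫ Spec.map _ = Spec.map _
  rw [← Spec.map_comp, map_comp_map]
  rfl

theorem ofDual_stalkPoint {G : CSch} {y : G.left} (g : M →ₗ[ℂ] ℂ)
    (φ : G.left.presheaf.stalk y →ₐ[ℂ] TrivSqZeroExt ℂ M) :
    ofDual g ≫ stalkPoint φ = dualPoint ((map g).comp φ) :=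
  specAlgMap_stalkPoint φ (map g)

theorem dualPoint_injective {G : CSch} {y : G.left}
    {φ ψ : G.left.presheaf.stalk y →ₐ[ℂ] DualNumber ℂ} (h : dualPoint φ = dualPoint ψ) : φ = ψ :=
  stalkPoint_injective h

/-- Composed with `ε ↦ 0`, `φ` has the maximal ideal as its kernel; hence `φ` is local. -/
theorem dualPoint_closedPoint {G : CSch} {y : G.left}
    (φ : G.left.presheaf.stalk y →ₐ[ℂ] DualNumber ℂ) :
    (dualPoint φ).left (IsLocalRing.closedPoint (DualNumber ℂ)) = y := by
  have : IsLocalHom φ.toRingHom := ⟨fun a ha => by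
    by_contra hu
    have h1 := (mem_maximalIdeal_iff_eval ((fstHom ℂ ℂ ℂ).comp φ)).1
      ((IsLocalRing.mem_maximalIdeal a).2 hu)
    have h2 := isUnit_iff_isUnit_fst.1 ha
    exact h2.ne_zero h1⟩
  exact (congrArg (G.left.fromSpecStalk y) (IsLocalRing.comap_closedPoint φ.toRingHom)).trans
    Scheme.fromSpecStalk_closedPoint

end SquareZero

section Representable

open TrivSqZeroExt

variable {X Δ : CSch} {i : Δ ⟶ X} {G : CSch} (r : (autPairFunctor i).toFunctor.RepresentableBy G)

theorem pointAut_comp {S T : CSch} (g : T ⟶ S) (f : S ⟶ G) :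
    pointAut r (g ≫ f) = autBaseChange X g (pointAut r f) :=
  congrArg Subtype.val (r.homEquiv_comp g f)

theorem pointAut_injective {S : CSch} {f g : S ⟶ G} (h : pointAut r f = pointAut r g) : f = g :=
  r.homEquiv.injective (Subtype.ext h)

theorem exists_pointAut {S : CSch} {σ : autOver X S} (h : σ ∈ (autPairFunctor i).obj (op S)) :
    ∃ f : S ⟶ G, pointAut r f = σ :=
  ⟨r.homEquiv.symm ⟨σ, h⟩, congrArg Subtype.val (r.homEquiv.apply_symm_apply ⟨σ, h⟩)⟩

theorem pointAut_identityPoint : pointAut r (identityPoint r) = 1 :=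
  congrArg Subtype.val (r.homEquiv.apply_symm_apply ⟨(1 : autOver X pt), autPair_one i pt⟩)

theorem pointAut_mem_autPair {S : CSch} (f : S ⟶ G) :
    pointAut r f ∈ (autPairFunctor i).obj (op S) :=
  (r.homEquiv f).2

theorem pointAut_mem_lie_iff (f : dual ⟶ G) :
    pointAut r f ∈ lie i ↔ dualZero ≫ f = identityPoint r := by
  constructor
  · intro h
    apply pointAut_injective r
    rw [pointAut_comp, pointAut_identityPoint]
    exact h.2
  · intro h
    refine ⟨pointAut_mem_autPair r f, ?_⟩
    rw [← pointAut_comp, h, pointAut_identityPoint]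

theorem autBaseChange_map_zero {σ : autOver X dual} (hσ : σ ∈ lie i) :
    autBaseChange X (dualEnd 0) σ = 1 := by
  have h0 : dualEnd 0 = dualScale 0 := by
    rw [← zero_smul ℂ (LinearMap.id : ℂ →ₗ[ℂ] ℂ)]
    rfl
  obtain ⟨δ, hδ⟩ := exists_isOnePlusEps hσ.2
  have h1 := hδ.autBaseChange_scale 0
  have h2 : IsOnePlusEps (1 : autOver X dual) 0 :=
    (pr_deforms X).congr (congrArg CommaMorphism.left (Category.id_comp _)).symm rfl
  rw [zero_smul] at h1
  rw [h0]
  exact h1.ext h2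

theorem autBaseChange_map_id (σ : autOver X dual) :
    autBaseChange X (dualEnd LinearMap.id) σ = σ := by
  have h0 : (dualEnd LinearMap.id) = 𝟙 dual := by
    rw [dualEnd, map_id]
    apply Over.OverMorphism.ext
    exact Spec.map_id _
  rw [h0, autBaseChange_id]

/-- The tangent vectors at the identity add by composition of automorphisms. -/
theorem pointAut_dualPoint_add {y : G.left} {φ ψ χ : G.left.presheaf.stalk y →ₐ[ℂ] DualNumber ℂ}
    (hφ : pointAut r (dualPoint φ) ∈ lie i)
    (hψ : pointAut r (dualPoint ψ) ∈ lie i)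
    (hχ : ∀ a, (χ a).fst = (φ a).fst) (hχ' : ∀ a, (χ a).snd = (φ a).snd + (ψ a).snd) :
    pointAut r (dualPoint χ) =
      pointAut r (dualPoint φ) * pointAut r (dualPoint ψ) := by
  -- `S` has two independent epsilons with all products zero. The product of the two automorphisms,
  -- one in each epsilon, is an `S`-point `f` of `G`. Killing one epsilon recovers a factor, and
  -- identifying the two gives the composite.
  let S := specAlg (TrivSqZeroExt ℂ (ℂ × ℂ))
  let j₁ : S ⟶ dual := toDual (LinearMap.inl ℂ ℂ ℂ)
  let j₂ : S ⟶ dual := toDual (LinearMap.inr ℂ ℂ ℂ)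
  obtain ⟨f, hf⟩ := exists_pointAut r (autPair_mul i S _ _
    (autPair_baseChange i j₁ _ hφ.1) (autPair_baseChange i j₂ _ hψ.1))
  have key : ∀ (g : ℂ × ℂ →ₗ[ℂ] ℂ), pointAut r (ofDual g ≫ f) =
      autBaseChange X (dualEnd (g.comp (LinearMap.inl ℂ ℂ ℂ)))
        (pointAut r (dualPoint φ)) *
      autBaseChange X (dualEnd (g.comp (LinearMap.inr ℂ ℂ ℂ)))
        (pointAut r (dualPoint ψ)) := fun g => by
    rw [pointAut_comp, hf, map_mul, ← autBaseChange_comp, ← autBaseChange_comp, ofDual_toDual,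
      ofDual_toDual]
  have h1 : ofDual (LinearMap.fst ℂ ℂ ℂ) ≫ f = dualPoint φ := by
    apply pointAut_injective r
    rw [key, LinearMap.fst_comp_inl, LinearMap.fst_comp_inr, autBaseChange_map_zero hψ,
      autBaseChange_map_id, mul_one]
  have h2 : ofDual (LinearMap.snd ℂ ℂ ℂ) ≫ f = dualPoint ψ := by
    apply pointAut_injective r
    rw [key, LinearMap.snd_comp_inl, LinearMap.snd_comp_inr, autBaseChange_map_zero hφ,
      autBaseChange_map_id, one_mul]
  have h3 : pointAut r (ofDual (LinearMap.fst ℂ ℂ ℂ + LinearMap.snd ℂ ℂ ℂ) ≫ f) = pointAut r (dualPoint φ) * pointAut r (dualPoint ψ) := by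
    rw [key, LinearMap.add_comp, LinearMap.add_comp, LinearMap.fst_comp_inl,
      LinearMap.fst_comp_inr, LinearMap.snd_comp_inl, LinearMap.snd_comp_inr, add_zero, zero_add,
      autBaseChange_map_id, autBaseChange_map_id]
  -- `f` is centred at `y` because its restriction `dualPoint φ` is. So it comes from a homomorphism
  -- on the local ring, whose two coefficients are those of `φ` and `ψ`; identifying the epsilons
  -- adds them.
  have hy : f.left (IsLocalRing.closedPoint (TrivSqZeroExt ℂ (ℂ × ℂ))) = y := by
    rw [← specAlgMap_map_closedPoint (LinearMap.fst ℂ ℂ ℂ)]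
    refine Eq.trans ?_ (dualPoint_closedPoint φ)
    exact congrArg (fun g : dual ⟶ G => g.left (IsLocalRing.closedPoint (DualNumber ℂ))) h1
  obtain ⟨Φ, rfl⟩ := exists_stalkPoint f hy
  have e1 := dualPoint_injective ((specAlgMap_stalkPoint Φ _).symm.trans h1)
  have e2 := dualPoint_injective ((specAlgMap_stalkPoint Φ _).symm.trans h2)
  rw [← h3, ofDual_stalkPoint]
  congr 2
  refine AlgHom.ext fun a => TrivSqZeroExt.ext ?_ ?_
  · rw [hχ, ← e1]
    simp
  · rw [hχ', ← e1, ← e2]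
    simp

theorem pointAut_dualPoint_scale {y : G.left} {φ χ : G.left.presheaf.stalk y →ₐ[ℂ] DualNumber ℂ}
    (c : ℂ) (hχ : ∀ a, (χ a).fst = (φ a).fst) (hχ' : ∀ a, (χ a).snd = c * (φ a).snd) :
    pointAut r (dualPoint χ) = autBaseChange X (dualScale c) (pointAut r (dualPoint φ)) := by
  have h : dualScale c ≫ dualPoint φ = dualPoint χ := by
    refine (ofDual_stalkPoint (c • LinearMap.id) φ).trans (congrArg dualPoint ?_)
    refine AlgHom.ext fun a => TrivSqZeroExt.ext ?_ ?_
    · rw [hχ]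
      simp
    · rw [hχ']
      simp
  rw [← h, pointAut_comp]

/-- The tangent space at the identity is isomorphic to `Lie(A_{X,Δ})`. -/
theorem exists_tangentSpace_equiv {L : Type*} [AddCommGroup L] [Module ℂ L] (e : lie i ≃ L)
    (hadd : ∀ σ τ, e (σ * τ) = e σ + e τ) (hsmul : ∀ (c : ℂ) (σ), e (lieScale i c σ) = c • e σ) :
    ∃ E : TangentSpace (identityPoint r) ≃ₗ[ℂ] L,
      ∀ v, ∃ f : dual ⟶ G, HasVelocity (identityPoint r) f v ∧
        ∃ h : pointAut r f ∈ lie i, E v = e ⟨pointAut r f, h⟩ := by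
  obtain ⟨ev, hev⟩ := exists_eval (identityPoint r)
  let f : TangentSpace (identityPoint r) → (dual ⟶ G) := fun v => dualPoint (tangentHom ev v)
  have hf : ∀ v, pointAut r (f v) ∈ lie i := fun v =>
    (pointAut_mem_lie_iff r _).2 ((dualZero_stalkPoint_iff hev _).2 fun a => fst_tangentHom ev v a)
  let E₀ : TangentSpace (identityPoint r) →ₗ[ℂ] L :=
    { toFun := fun v => e ⟨pointAut r (f v), hf v⟩
      map_add' := fun v w => by
        rw [← hadd]
        refine congrArg e (Subtype.ext ?_)
        exact pointAut_dualPoint_add r (hf v) (hf w) (fun a => by simp)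
          (fun a => by simp [pointDerivation_add_left])
      map_smul' := fun c v => by
        rw [RingHom.id_apply, ← hsmul]
        refine congrArg e (Subtype.ext ?_)
        exact pointAut_dualPoint_scale r c (fun a => by simp)
          (fun a => by simp [pointDerivation_smul_left]) }
  have hE : Function.Bijective E₀ := by
    refine ⟨fun v w h => ?_, fun l => ?_⟩
    · have h1 : pointAut r (f v) = pointAut r (f w) := congrArg (fun σ : lie i => σ.1) (e.injective h)
      exact tangentHom_injective ev (dualPoint_injective (pointAut_injective r h1))
    -- An element of the Lie algebra is a `ℂ[ε]`-point of `G` reducing to the identity point; it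
    -- factors through the local ring there and is therefore given by a tangent vector.
    · obtain ⟨σ, rfl⟩ := e.surjective l
      obtain ⟨g, hg⟩ := exists_pointAut r σ.2.1
      have hg0 : dualZero ≫ g = identityPoint r :=
        (pointAut_mem_lie_iff r g).1 (hg ▸ σ.2)
      obtain ⟨φ, rfl⟩ := exists_stalkPoint (S := DualNumber ℂ) g (left_closedPoint_of_dualZero hg0)
      obtain ⟨v, rfl⟩ := exists_tangentHom_eq ev φ ((dualZero_stalkPoint_iff hev φ).1 hg0)
      exact ⟨v, congrArg e (Subtype.ext hg)⟩
  refine ⟨LinearEquiv.ofBijective E₀ hE, fun v => ⟨f v, ?_, hf v, rfl⟩⟩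
  exact ⟨CommRingCat.ofHom (tangentHom ev v).toRingHom, rfl, fun a =>
    ⟨pointDerivation ev v a.1, tangentHom_of_mem ev v a, pointDerivation_of_mem ev v a⟩⟩

end Representable

end LogAut

end

theorem mainTheorem5 (X Δ : LogAut.CSch) (i : Δ ⟶ X)
    [IsIntegral X.left] [IsProper X.hom]
    (hX : ∀ x : X.left, IsIntegrallyClosed (X.left.presheaf.stalk x))
    (hΔ : LogAut.IsReducedDivisor i) :
    Function.Injective (LogAut.toVectorField i) ∧
    ∃ e : LogAut.lie i ≃ LogAut.LogVectorField i,
      (∀ σ, LogAut.IsOnePlusEps σ.1 (LogAut.toVectorField i (e σ))) ∧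
      (∀ σ τ, e (σ * τ) = e σ + e τ) ∧
      (∀ (c : ℂ) (σ), e (LogAut.lieScale i c σ) = c • e σ) ∧
      ∀ (G : LogAut.CSch) (r : (LogAut.autPairFunctor i).toFunctor.RepresentableBy G),
        ∃ L : LogAut.TangentSpace (LogAut.identityPoint r) ≃ₗ[ℂ] LogAut.LogVectorField i,
          ∀ v, ∃ f : LogAut.dual ⟶ G, LogAut.HasVelocity (LogAut.identityPoint r) f v ∧
            ∃ h : LogAut.pointAut r f ∈ LogAut.lie i, L v = e ⟨LogAut.pointAut r f, h⟩ := by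
  -- Properness supplies finite type over `ℂ`, hence the noetherian hypothesis of the
  -- codimension-one arguments.
  have : IsLocallyNoetherian X.left := LocallyOfFiniteType.isLocallyNoetherian X.hom
  obtain ⟨e, he, hadd, hsmul⟩ := LogAut.exists_lie_equiv hX hΔ
  exact ⟨LogAut.toVectorField_injective i, e, he, hadd, hsmul, fun G r =>
    LogAut.exists_tangentSpace_equiv r e hadd hsmul⟩
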